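/- Let $M$ be a four-dimensional smooth (Hausdorff) manifold with a smooth Lorentzian metric $g$ of signature $(1,3)$ and a smooth metric volume form $\tau_g$ (value $\pm1$ on orthonormal bases); let $D$ be the Levi-Civita connection and let $T$ be a $(1,1)$-tensor field on $M$ with components $T^\alpha_\beta$. Curvature conventions: $[D_{\partial_\alpha},D_{\partial_\beta}]\partial_\rho=R^{\mu}{}_{\rho\alpha\beta}\partial_\mu$ in a coordinate basis, $R_{\nu\sigma}=R^{\mu}{}_{\nu\sigma\mu}$, $R=g^{\nu\sigma}R_{\nu\sigma}$, $G^\alpha_\beta=R^\alpha_\beta-\tfrac12\delta^\alpha_\beta R$. In these conventions the Einstein equation is $$G^\alpha_\beta=-T^\alpha_\beta .\tag{EE}$$ (With the opposite sign convention for the Ricci tensor it reads $G=T$.) A $(1,1)$-tensor field $W$ acts on $1$-forms by $W(A)_\beta=A_\alpha W^\alpha_\beta$. On $r$-forms, let $\star$ be the Hodge star, $(\star\alpha)_{c_1\dots c_{4-r}}=\tfrac1{r!}\alpha^{b_1\dots b_r}(\tau_g)_{b_1\dots b_rc_1\dots c_{4-r}}$, let $\delta=(-1)^r\star^{-1}d\,\star$,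 and let $\boldsymbol\partial\cdot\boldsymbol\partial=g^{\alpha\beta}(D_{\partial_\alpha}D_{\partial_\beta}-\Gamma^\rho_{\alpha\beta}D_{\partial_\rho})$. Differential forms are regarded as sections of the Clifford bundle $\mathcal{C}\ell(M,\mathtt g)$ of the cotangent bundle ($ab+ba=2\,\mathtt g(a,b)$ for $1$-forms $a,b$, where $\mathtt g$ is the induced metric $g^{\alpha\beta}$ on the cotangent bundle), and $\boldsymbol\partial=dx^\alpha D_{\partial_\alpha}$ (Clifford product) is the Dirac operator. For a smooth vector field $\mathbf A$ put $A=g(\mathbf A,\cdot)$, $F=dA$ and $$J_A=-T(A)+\tfrac12(\operatorname{tr}T)\,A+d\delta A+\boldsymbol\partial\cdot\boldsymbol\partial A .$$ The Maxwell-like equation of $\mathbf A$ is the equation of sections of the Clifford bundle $$\boldsymbol\partial F=J_A .\tag{MLE$_{\mathbf A}$}$$ Then: 1. (EE) holds if and only if (MLE$_{\mathbf A}$) holds for every smooth vector field $\mathbf A$. 2. If $\mathcal V$ is a set of smooth vector fields on $M$ whose values span $T_xM$ for every $x\in M$, and (MLE$_{\mathbf A}$) holds for every $\mathbf A\in\mathcal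 V$, then (EE) holds. 3. For every smooth vector field $\mathbf A$: (a) (MLE$_{\mathbf A}$) holds if and only if $dF=0$ and $\delta F=-J_A$; (b) if $R=\operatorname{tr}T$ on $M$, then (MLE$_{\mathbf A}$) holds if and only if $G(A)=-T(A)$; (c) if (MLE$_{\mathbf A}$) holds, then $J_A$ is conserved, i.e. $\delta J_A=0$. -/

import Mathlib

open scoped Manifold ContDiff

noncomputable section

namespace Komar

/-! ### Linear algebra on the model space

The model space of a four-dimensional manifold is `ℝ⁴`.  In Mathlib the tangent space at `x` is
identified with the model space by means of the preferred chart at `x`; under this identification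
the standard basis `e 0, …, e 3` is the coordinate basis `∂₀, …, ∂₃` of that chart at `x`. -/

/-- The model space `ℝ⁴`. -/
abbrev E4 : Type := EuclideanSpace ℝ (Fin 4)

/-- The standard basis vectors of `ℝ⁴`. -/
def e (i : Fin 4) : E4 := EuclideanSpace.single i (1 : ℝ)

/-- The Minkowski matrix `diag (1, -1, -1, -1)`. -/
def minkowski : Matrix (Fin 4) (Fin 4) ℝ := Matrix.diagonal ![1, -1, -1, -1]

/-- The linear endomorphism `v ↦ (∑ⱼ Bᵏⱼ vʲ) eₖ` of `ℝ⁴` given by a matrix `B`. -/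
def matEnd (B : Matrix (Fin 4) (Fin 4) ℝ) : E4 →L[ℝ] E4 := Matrix.toEuclideanCLM (𝕜 := ℝ) B

/-- The action of an endomorphism `L` as a derivation on an alternating form `α`:
`(L · α)(v₁, …, v_p) = ∑ₖ α(v₁, …, L vₖ, …, v_p)`. -/
def derivAction {p : ℕ} (L : E4 →L[ℝ] E4) (α : E4 [⋀^Fin p]→L[ℝ] ℝ) : E4 [⋀^Fin p]→L[ℝ] ℝ :=
  { ∑ k : Fin p, α.toContinuousMultilinearMap.compContinuousLinearMap
      (Function.update (fun _ : Fin p => ContinuousLinearMap.id ℝ E4) k L) with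
    map_eq_zero_of_eq' := by
      intro v i j hij hne
      have key : ∀ k : Fin p, (fun l => (Function.update
          (fun _ : Fin p => ContinuousLinearMap.id ℝ E4) k L l) (v l))
          = Function.update v k (L (v k)) := by
        intro k
        funext l
        by_cases h : l = k
        · subst h; simp
        · simp [h]
      have hsum : (∑ k : Fin p, α (Function.update v k (L (v k)))) = 0 := by
        have h0 : ∀ k : Fin p, k ≠ i → k ≠ j → α (Function.update v k (L (v k))) = 0 := by
          intro k hki hkj
          refine α.map_eq_zero_of_eq _ ?_ hne
          simp [Function.update_of_ne hki.symm, Function.update_of_ne hkj.symm, hij]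
        rw [Fintype.sum_eq_add i j hne (fun k hk => h0 k hk.1 hk.2)]
        have hsw : Function.update v j (L (v j))
            = Function.update v i (L (v i)) ∘ Equiv.swap i j := by
          funext l
          by_cases hi : l = i
          · subst hi
            simp [Function.update_of_ne hne, Function.update_of_ne hne.symm, hij]
          · by_cases hj : l = j
            · subst hj
              simp [hij]
            · simp [Equiv.swap_apply_of_ne_of_ne hi hj, hi, hj]
        have hs : α (Function.update v i (L (v i)) ∘ Equiv.swap i j)
            = - α (Function.update v i (L (v i))) := α.toAlternatingMap.map_swap _ hne
        rw [hsw, hs, add_neg_cancel]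
      simpa [key] using hsum }

theorem derivAction_apply {p : ℕ} (L : E4 →L[ℝ] E4) (α : E4 [⋀^Fin p]→L[ℝ] ℝ)
    (v : Fin p → E4) :
    derivAction L α v = ∑ k : Fin p, α (Function.update v k (L (v k))) := by
  have key : ∀ k : Fin p, (fun l => (Function.update
      (fun _ : Fin p => ContinuousLinearMap.id ℝ E4) k L l) (v l))
      = Function.update v k (L (v k)) := by
    intro k
    funext l
    by_cases h : l = k
    · subst h; simp
    · simp [h]
  show (∑ k : Fin p, α.toContinuousMultilinearMap.compContinuousLinearMap
      (Function.update (fun _ : Fin p => ContinuousLinearMap.id ℝ E4) k L)) v = _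
  simp [key]

/-- Insertion of `p` vectors in the first slots of a `4`-form:
`(w₁, …, w_q) ↦ τ(u₁, …, u_p, w₁, …, w_q)`, where `p + q = 4`. -/
def insertFirst {p q : ℕ} (h : p + q = 4) (u : Fin p → E4) (τ : E4 [⋀^Fin 4]→L[ℝ] ℝ) :
    E4 [⋀^Fin q]→L[ℝ] ℝ where
  toFun w := τ (Sum.elim u w ∘ ((finCongr h.symm).trans finSumFinEquiv.symm))
  map_update_add' := by
    intro _ w k a b
    have hd : ‹DecidableEq (Fin q)› = instDecidableEqFin q := Subsingleton.elim _ _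
    subst hd
    simp only [← Sum.update_elim_inr, Function.update_comp_equiv, τ.map_update_add]
  map_update_smul' := by
    intro _ w k c a
    have hd : ‹DecidableEq (Fin q)› = instDecidableEqFin q := Subsingleton.elim _ _
    subst hd
    simp only [← Sum.update_elim_inr, Function.update_comp_equiv, τ.map_update_smul]
  map_eq_zero_of_eq' := by
    intro w i j hij hne
    refine τ.map_eq_zero_of_eq (i := ((finCongr h.symm).trans finSumFinEquiv.symm).symm (.inr i))
      (j := ((finCongr h.symm).trans finSumFinEquiv.symm).symm (.inr j)) _ ?_ ?_
    · simp only [Function.comp_apply, Equiv.apply_symm_apply, Sum.elim_inr, hij]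
    · intro hc
      exact hne (Sum.inr_injective (Equiv.injective _ hc))
  cont := by
    refine τ.cont.comp (continuous_pi fun i => ?_)
    simp only [Function.comp_apply]
    rcases ((finCongr h.symm).trans finSumFinEquiv.symm) i with a | b
    · exact continuous_const
    · exact continuous_apply b

/-- The Hodge star `⋆ : ⋀ᵖ → ⋀^q`, `p + q = 4`, for the inverse metric matrix `G = (g^{ij})` and
the volume form `τ`:
`(⋆α)(w₁, …, w_q) = (1/p!) α_{a₁…a_p} g^{a₁b₁} ⋯ g^{a_pb_p} τ(e_{b₁}, …, e_{b_p}, w₁, …, w_q)`. -/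
def hodge {p q : ℕ} (h : p + q = 4) (G : Matrix (Fin 4) (Fin 4) ℝ) (τ : E4 [⋀^Fin 4]→L[ℝ] ℝ)
    (α : E4 [⋀^Fin p]→L[ℝ] ℝ) : E4 [⋀^Fin q]→L[ℝ] ℝ :=
  ((p.factorial : ℝ)⁻¹) • ∑ a : Fin p → Fin 4, ∑ b : Fin p → Fin 4,
    (α (fun i => e (a i)) * ∏ i, G (a i) (b i)) • insertFirst h (fun i => e (b i)) τ

/-- The partial derivative `∂ᵢ f` at `y`, for a function on `ℝ⁴`. -/
def pd {F : Type*} [NormedAddCommGroup F] [NormedSpace ℝ F] (i : Fin 4) (f : E4 → F) (y : E4) : F :=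
  fderiv ℝ f y (e i)

/-! ### Fields on a manifold -/

section Manifold

variable (M : Type*) [TopologicalSpace M] [ChartedSpace E4 M]

/-- The tangent space at `x`. This is Mathlib's `TangentSpace (𝓡 4) x`, which is by definition the
model space; the abbreviation makes the identification transparent. -/
abbrev Tan {M : Type*} [TopologicalSpace M] [ChartedSpace E4 M] (_x : M) : Type := E4

theorem tan_eq (x : M) : Tan x = TangentSpace (𝓡 4) x := rfl

/-- A field of `p`-forms on `M` (no regularity included). -/
abbrev Form (p : ℕ) : Type _ := Π x : M, Tan x [⋀^Fin p]→L[ℝ] ℝ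

/-- A vector field on `M` (no regularity included). -/
abbrev VField : Type _ := Π x : M, Tan x

/-- A `(1,1)`-tensor field on `M` (no regularity included), as a field of endomorphisms of the
tangent spaces. Its components at `x` are `Wᵅ_β = (W_x ∂_β)ᵅ`. -/
abbrev EndField : Type _ := Π x : M, Tan x →L[ℝ] Tan x

variable {M}

/-- The coordinates of the point `x` in the preferred chart at `x`. -/
def base (x : M) : E4 := extChartAt (𝓡 4) x x

/-- The differential at `y` of the inverse of the preferred chart `φ` at `x₀`; it maps the standard
basis of `ℝ⁴` to the coordinate basis of that chart at the point `φ⁻¹ y`. -/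
def chartDiff (x₀ : M) (y : E4) :
    E4 →L[ℝ] Tan ((extChartAt (𝓡 4) x₀).symm y) :=
  mfderiv 𝓘(ℝ, E4) (𝓡 4) (extChartAt (𝓡 4) x₀).symm y

/-- The expression of a field of `p`-forms in the preferred chart at `x₀`
(the pullback by the inverse of the chart). -/
def chartForm {p : ℕ} (α : Form M p) (x₀ : M) (y : E4) : E4 [⋀^Fin p]→L[ℝ] ℝ :=
  (α ((extChartAt (𝓡 4) x₀).symm y)).compContinuousLinearMap (chartDiff x₀ y)

/-- Smooth `p`-forms. -/
def SmoothForm {p : ℕ} (α : Form M p) : Prop :=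
  ∀ x₀ : M, ContDiffOn ℝ ∞ (chartForm α x₀) (extChartAt (𝓡 4) x₀).target

/-- Smooth vector fields. -/
def SmoothVField [IsManifold (𝓡 4) ∞ M] (A : VField M) : Prop :=
  ContMDiff (𝓡 4) (𝓡 4).tangent ∞ (fun x => (⟨x, A x⟩ : TangentBundle (𝓡 4) M))

/-- The exterior derivative on `M`: at `x` it is computed in the preferred chart at `x`. -/
def extd {p : ℕ} (α : Form M p) : Form M (p + 1) :=
  fun x => extDeriv (chartForm α x) (base x)

/-- A `(1,1)`-tensor field `W` acting on a `1`-form field: `W(A)_β = A_α Wᵅ_β`. -/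
def extensor (W : EndField M) (A : Form M 1) : Form M 1 :=
  fun x => (A x).compContinuousLinearMap (W x)

end Manifold

/-! ### Lorentzian spacetimes -/

/-- An oriented four-dimensional Lorentzian manifold of signature `(1, 3)`: a smooth metric `g` and
a smooth metric volume form `τ`, that is, a `4`-form with value `±1` on orthonormal bases. -/
structure Spacetime (M : Type*) [TopologicalSpace M] [ChartedSpace E4 M] where
  /-- the metric -/
  g : Π x : M, Tan x →L[ℝ] Tan x →L[ℝ] ℝ
  symm : ∀ (x : M) (v w : Tan x), g x v w = g x w v
  signature : ∀ x : M, ∃ b : Module.Basis (Fin 4) ℝ (Tan x),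
    ∀ i j, g x (b i) (b j) = minkowski i j
  smooth_g : ∀ (x₀ : M) (i j : Fin 4), ContDiffOn ℝ ∞
    (fun y => g ((extChartAt (𝓡 4) x₀).symm y) (chartDiff x₀ y (e i)) (chartDiff x₀ y (e j)))
    (extChartAt (𝓡 4) x₀).target
  /-- the volume form -/
  τ : Form M 4
  τ_unit : ∀ (x : M) (b : Fin 4 → Tan x),
    (∀ i j, g x (b i) (b j) = minkowski i j) → τ x b = 1 ∨ τ x b = -1
  smooth_τ : SmoothForm τ

namespace Spacetime

variable {M : Type*} [TopologicalSpace M] [ChartedSpace E4 M] (S : Spacetime M)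

/-! #### The Levi-Civita connection and its curvature in a chart -/

/-- The matrix `g_{ij}` of the metric at the point with coordinates `y` of the preferred chart at
`x₀`. -/
def gram (x₀ : M) (y : E4) : Matrix (Fin 4) (Fin 4) ℝ := Matrix.of fun i j =>
  S.g ((extChartAt (𝓡 4) x₀).symm y) (chartDiff x₀ y (e i)) (chartDiff x₀ y (e j))

/-- The Christoffel symbols `Γᵏᵢⱼ` of the Levi-Civita connection `D`, with `D_{∂ᵢ} ∂ⱼ = Γᵏᵢⱼ ∂ₖ`. -/
def christoffel (x₀ : M) (k i j : Fin 4) (y : E4) : ℝ :=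
  (1 / 2) * ∑ l, (S.gram x₀ y)⁻¹ k l *
    (pd i (fun z => S.gram x₀ z j l) y + pd j (fun z => S.gram x₀ z i l) y
      - pd l (fun z => S.gram x₀ z i j) y)

/-- The components `Rᵐ_{r a b}` of the Riemann tensor,
`([D_{∂ₐ}, D_{∂_b}]) ∂ᵣ = Rᵐ_{r a b} ∂ₘ`. -/
def riemann (x₀ : M) (m r a b : Fin 4) (y : E4) : ℝ :=
  pd a (S.christoffel x₀ m b r) y - pd b (S.christoffel x₀ m a r) y
    + ∑ s, (S.christoffel x₀ m a s y * S.christoffel x₀ s b r y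
      - S.christoffel x₀ m b s y * S.christoffel x₀ s a r y)

/-- The covariant derivative `D_{∂ᵢ}` of `p`-forms in the preferred chart at `x₀`:
`(D_{∂ᵢ} α)(v₁, …, v_p) = (∂ᵢ α)(v₁, …, v_p) - ∑ₖ α(v₁, …, Γᵢ vₖ, …, v_p)`, where
`Γᵢ ∂ⱼ = Γᵏᵢⱼ ∂ₖ`. -/
def covD {p : ℕ} (x₀ : M) (i : Fin 4) (α : E4 → E4 [⋀^Fin p]→L[ℝ] ℝ) (y : E4) :
    E4 [⋀^Fin p]→L[ℝ] ℝ :=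
  pd i α y - derivAction (matEnd (Matrix.of fun k j => S.christoffel x₀ k i j y)) (α y)

/-! #### Tensors and operators on `M` -/

/-- The matrix `g^{ij}` inverse to `g_{ij} = g(∂ᵢ, ∂ⱼ)`, at the point `x` and in the coordinate
basis of the preferred chart at `x`. -/
def ginv (x : M) : Matrix (Fin 4) (Fin 4) ℝ := (S.gram x (base x))⁻¹

/-- The components `R_{rs} = Rᵐ_{r s m}` of the Ricci tensor at `x`. -/
def ricci (x : M) : Matrix (Fin 4) (Fin 4) ℝ := Matrix.of fun r s =>
  ∑ m, S.riemann x m r s m (base x)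

/-- The scalar curvature `R = g^{rs} R_{rs}`. -/
def scalar (x : M) : ℝ := ∑ r, ∑ s, S.ginv x r s * S.ricci x r s

/-- The Einstein tensor `Gᵅ_β = Rᵅ_β - (1/2) δᵅ_β R`. -/
def einstein : EndField M := fun x =>
  matEnd (S.ginv x * S.ricci x - (S.scalar x / 2) • (1 : Matrix (Fin 4) (Fin 4) ℝ))

/-- The covariant d'Alembertian on `p`-forms,
`∂·∂ α = g^{ij} (D_{∂ᵢ} D_{∂ⱼ} - Γᵏᵢⱼ D_{∂ₖ}) α`. -/
def dAlembert {p : ℕ} (α : Form M p) : Form M p := fun x =>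
  ∑ i, ∑ j, S.ginv x i j •
    (S.covD x i (S.covD x j (chartForm α x)) (base x)
      - ∑ k, S.christoffel x k i j (base x) • S.covD x k (chartForm α x) (base x))

/-- The Hodge star on forms, `⋆ : Ωᵖ → Ω^q` with `p + q = 4`. -/
def star {p q : ℕ} (h : p + q = 4) (α : Form M p) : Form M q := fun x =>
  hodge h (S.ginv x) (S.τ x) (α x)

/-- The inverse Hodge star on `p`-forms, `⋆⁻¹ = (-1)^{p(4-p)} sgn(det g) ⋆`. -/
def starInv {p q : ℕ} (h : p + q = 4) (α : Form M p) : Form M q := fun x =>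
  ((-1 : ℝ) ^ (p * q) * Real.sign (S.gram x (base x)).det) • S.star h α x

/-- The Hodge codifferential `δ α = (-1)^r ⋆⁻¹ d ⋆ α` on forms of degree `r = p + 1`. -/
def codiff {p : ℕ} (q : ℕ) (h : p + 1 + q = 4) (α : Form M (p + 1)) : Form M p := fun x =>
  (-1 : ℝ) ^ (p + 1) • S.starInv (by omega : q + 1 + p = 4) (extd (S.star h α)) x

/-! #### The Clifford bundle and the Dirac operator -/

/-- The quadratic form `α ↦ g^{ij} αᵢ αⱼ` of the metric of the cotangent space at `x`. -/
def cometric (x : M) : QuadraticForm ℝ (Tan x →L[ℝ] ℝ) :=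
  (Matrix.toQuadraticForm' (S.ginv x)).comp
    (LinearMap.pi fun i : Fin 4 =>
      ({ toFun := fun α => α (e i), map_add' := fun _ _ => rfl, map_smul' := fun _ _ => rfl } :
        (Tan x →L[ℝ] ℝ) →ₗ[ℝ] ℝ))

/-- The fibre at `x` of the Clifford bundle of differential forms, with `a b + b a = 2 g(a, b)`. -/
abbrev Cliff (x : M) : Type _ := CliffordAlgebra (S.cometric x)

/-- The covector `dxⁱ` at `x`, in the preferred chart at `x`, as an element of the Clifford
algebra. -/
def theta (x : M) (i : Fin 4) : S.Cliff x :=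
  CliffordAlgebra.ι (S.cometric x) (EuclideanSpace.proj i : E4 →L[ℝ] ℝ)

/-- The embedding of `p`-forms in the Clifford algebra:
`α = (1/p!) α_{a₁…a_p} dx^{a₁} ∧ ⋯ ∧ dx^{a_p} ↦ (1/p!) α_{a₁…a_p} dx^{a₁} ⋯ dx^{a_p}`. -/
def toCliff {p : ℕ} (x : M) (α : Tan x [⋀^Fin p]→L[ℝ] ℝ) : S.Cliff x :=
  ((p.factorial : ℝ)⁻¹) • ∑ a : Fin p → Fin 4,
    α (fun i => e (a i)) • (List.ofFn fun i => S.theta x (a i)).prod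

/-- The Dirac operator `∂ = dxⁱ D_{∂ᵢ}` (Clifford product) on `p`-forms. -/
def dirac {p : ℕ} (α : Form M p) (x : M) : S.Cliff x :=
  ∑ i, S.theta x i * S.toCliff x (S.covD x i (chartForm α x) (base x))

/-! #### The Komar current, the Maxwell-like equation and the Einstein equation -/

/-- The `1`-form `A = g(𝐀, ·)` of a vector field `𝐀`. -/
def flat (A : VField M) : Form M 1 := fun x =>
  ContinuousAlternatingMap.ofSubsingleton ℝ (Tan x) ℝ (0 : Fin 1) (S.g x (A x))

/-- The `2`-form `F = dA`. -/
def field (A : VField M) : Form M 2 := extd (S.flat A)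

/-- The trace `tr W = W^μ_μ` of a `(1,1)`-tensor field. -/
def trace (W : EndField M) (x : M) : ℝ :=
  LinearMap.trace ℝ (Tan x) (W x : Tan x →ₗ[ℝ] Tan x)

/-- The Komar current `J_A = - T(A) + (1/2) (tr T) A + d δ A + ∂·∂ A` in terms of the
energy-momentum tensor `T`. -/
def komarCurrent (T : EndField M) (A : VField M) : Form M 1 := fun x =>
  - extensor T (S.flat A) x + (trace T x / 2) • S.flat A x
    + extd (S.codiff 3 rfl (S.flat A)) x + S.dAlembert (S.flat A) x

/-- The Einstein equation `Gᵅ_β = - Tᵅ_β`, in the convention `R_{rs} = Rᵐ_{r s m}`. -/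
def EinsteinEquation (T : EndField M) : Prop := ∀ x : M, S.einstein x = - T x

/-- The Maxwell-like equation `∂F = J_A` in the Clifford bundle. -/
def MaxwellLike (T : EndField M) (A : VField M) : Prop :=
  ∀ x : M, S.dirac (S.field A) x = S.toCliff x (S.komarCurrent T A x)

end Spacetime

end Komar

end

noncomputable section

/-! ### Charts, transition maps and the exterior derivative -/

namespace Komar

variable {M : Type*} [TopologicalSpace M] [ChartedSpace E4 M]

/-! Since F = dA is closed, its Clifford derivative has no three-form part, and ∂F reduces to the
one-form −δF (`dirac_of_closed`). One-forms embed injectively in the Clifford algebra, so the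
Maxwell-like equation says δF = −J_A. The Weitzenböck formula −δdA = ∂·∂A + dδA + Ric(A)
(`codiff_extd`) then removes every derivative of A: what is left is the pointwise linear equation
Ric(A) = −T(A) + ½(tr T)A (`maxwellLike_iff_ricci`).

In dimension four, the same equation without A is the trace-reversed Einstein equation
(`einstein_eq_neg_iff`), because taking the trace of either form gives R = tr T. Hence the Einstein
equation yields the Maxwell-like equation of every A. Conversely, the contracted equation at x is
linear in the value of A at x, so spanning values and nondegeneracy of g recover the Einstein
equation; bump functions show that the values of all smooth fields span. For a single A the trace
cannot be taken, which is why R = tr T is assumed when Ric is replaced by G. Conservation is δδ = 0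
applied to J_A = −δF.

Most of the work links δ, defined through d and the Hodge star, with covariant derivatives. It is
done in charts, with the connection as matrices Γᵢ: metric, torsion-free, and preserving the volume
form, the last because τ(e)² = −det g. This gives d⋆α = (div α)τ for one-forms and d⋆β = −⋆(div β)
for two-forms (`extDeriv_hodge_one`, `extDeriv_hodge_two`). With ⋆⋆ = −1 on functions and ⋆⋆ = 1 on
one-forms, both codifferentials are minus divergences. The Weitzenböck formula then follows from the
Ricci identity and the skewness of the curvature, and the Clifford reduction is the algebraic lemma
`clifford_contract`. -/

theorem two_le_infty : minSmoothness ℝ 2 ≤ (∞ : WithTop ℕ∞) := by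
  simpa using WithTop.coe_le_coe.2 (le_top : (2 : ℕ∞) ≤ ⊤)

theorem range_model : Set.range (𝓡 4) = Set.univ := by simp

theorem isOpen_chart_target (x₀ : M) : IsOpen (extChartAt (𝓡 4) x₀).target :=
  isOpen_extChartAt_target x₀

theorem base_mem_target (x : M) : base x ∈ (extChartAt (𝓡 4) x).target :=
  mem_extChartAt_target x

theorem chart_symm_base (x : M) : (extChartAt (𝓡 4) x).symm (base x) = x :=
  extChartAt_to_inv x

variable [IsManifold (𝓡 4) ∞ M]

theorem tangentCoordChange_eq_fderiv (x y z : M) : tangentCoordChange (𝓡 4) x y z =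
    fderiv ℝ (extChartAt (𝓡 4) y ∘ (extChartAt (𝓡 4) x).symm) (extChartAt (𝓡 4) x z) := by
  rw [tangentCoordChange_def, range_model, fderivWithin_univ]

/-- Tangent spaces are identified with ℝ⁴ through preferred charts, so differentiating the inverse
of one chart amounts to changing to the preferred chart at the image point. The cocycle rules of
`tangentCoordChange` thereby become available. -/
theorem chartDiff_eq (x₀ : M) {y : E4} (hy : y ∈ (extChartAt (𝓡 4) x₀).target) :
    chartDiff x₀ y = tangentCoordChange (𝓡 4) x₀ ((extChartAt (𝓡 4) x₀).symm y)
      ((extChartAt (𝓡 4) x₀).symm y) := by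
  have h : MDifferentiableAt 𝓘(ℝ, E4) (𝓡 4) (extChartAt (𝓡 4) x₀).symm y :=
    ((contMDiffOn_extChartAt_symm (n := 1) x₀).contMDiffAt
      ((isOpen_chart_target x₀).mem_nhds hy)).mdifferentiableAt one_ne_zero
  -- `mfderiv` is an `if` with junk value 0; `if_pos` selects the genuine branch.
  have h' : chartDiff x₀ y = fderivWithin ℝ (writtenInExtChartAt 𝓘(ℝ, E4) (𝓡 4) y
      (extChartAt (𝓡 4) x₀).symm) (Set.range 𝓘(ℝ, E4)) (extChartAt 𝓘(ℝ, E4) y y) := if_pos h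
  rw [h', tangentCoordChange_eq_fderiv]
  simp only [writtenInExtChartAt, extChartAt_model_space_eq_id, PartialEquiv.refl_symm,
    PartialEquiv.refl_coe, Function.comp_id, ModelWithCorners.range_eq_univ, fderivWithin_univ,
    id_eq, (extChartAt (𝓡 4) x₀).right_inv hy]

/-- This is what lets operators computed in the preferred chart at x take values directly in forms
on the tangent space at x, with no transition factor. -/
theorem chartDiff_base (x : M) : chartDiff x (base x) = ContinuousLinearMap.id ℝ E4 := by
  rw [chartDiff_eq x (base_mem_target x), chart_symm_base]
  ext1 v
  exact tangentCoordChange_self (mem_extChartAt_source x)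

theorem chartForm_base {p : ℕ} (α : Form M p) (x : M) : chartForm α x (base x) = α x := by
  rw [chartForm, chartDiff_base, chart_symm_base]
  rfl

/-- The inverse of `chartDiff`, the differential of the chart. -/
def chartDiffInv (x₀ x : M) : Tan x →L[ℝ] E4 := tangentCoordChange (𝓡 4) x x₀ x

theorem chartDiff_comp_inv (x₀ : M) {x : M} (hx : x ∈ (extChartAt (𝓡 4) x₀).source) (v : E4) :
    chartDiff x₀ (extChartAt (𝓡 4) x₀ x) (chartDiffInv x₀ x v) = v := by
  rw [chartDiff_eq x₀ ((extChartAt (𝓡 4) x₀).map_source hx), (extChartAt (𝓡 4) x₀).left_inv hx,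
    chartDiffInv, tangentCoordChange_comp ⟨⟨mem_extChartAt_source x, hx⟩, mem_extChartAt_source x⟩,
    tangentCoordChange_self (mem_extChartAt_source x)]

theorem chartDiffInv_comp (x₀ : M) {y : E4} (hy : y ∈ (extChartAt (𝓡 4) x₀).target) (v : E4) :
    chartDiffInv x₀ ((extChartAt (𝓡 4) x₀).symm y) (chartDiff x₀ y v) = v := by
  have hx := (extChartAt (𝓡 4) x₀).map_target hy
  rw [chartDiff_eq x₀ hy, chartDiffInv, tangentCoordChange_comp
    ⟨⟨hx, mem_extChartAt_source _⟩, hx⟩, tangentCoordChange_self hx]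

/-- The differential of the chart as a linear equivalence. -/
def chartEquiv (x₀ : M) {y : E4} (hy : y ∈ (extChartAt (𝓡 4) x₀).target) : E4 ≃ₗ[ℝ] E4 where
  toFun := chartDiff x₀ y
  map_add' := map_add _
  map_smul' := map_smul _
  invFun := chartDiffInv x₀ ((extChartAt (𝓡 4) x₀).symm y)
  left_inv := chartDiffInv_comp x₀ hy
  right_inv v := by
    have := chartDiff_comp_inv x₀ ((extChartAt (𝓡 4) x₀).map_target hy) v
    rwa [(extChartAt (𝓡 4) x₀).right_inv hy] at this

/-- The change of coordinates of differential forms. -/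
theorem chartForm_change {p : ℕ} (α : Form M p) (x₀ x₁ : M) {y : E4}
    (hy : y ∈ (extChartAt (𝓡 4) x₀).target)
    (hy' : (extChartAt (𝓡 4) x₀).symm y ∈ (extChartAt (𝓡 4) x₁).source) :
    chartForm α x₀ y =
      (chartForm α x₁ ((extChartAt (𝓡 4) x₁ ∘ (extChartAt (𝓡 4) x₀).symm) y)).compContinuousLinearMap
        (fderiv ℝ (extChartAt (𝓡 4) x₁ ∘ (extChartAt (𝓡 4) x₀).symm) y) := by
  have h1 := tangentCoordChange_eq_fderiv x₀ x₁ ((extChartAt (𝓡 4) x₀).symm y)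
  rw [(extChartAt (𝓡 4) x₀).right_inv hy] at h1
  have hx := (extChartAt (𝓡 4) x₀).map_target hy
  rw [chartForm, chartForm, ← h1, chartDiff_eq x₀ hy, Function.comp_apply,
    chartDiff_eq x₁ ((extChartAt (𝓡 4) x₁).map_source hy'), (extChartAt (𝓡 4) x₁).left_inv hy']
  ext v
  simp only [ContinuousAlternatingMap.compContinuousLinearMap_apply]
  congr 1
  funext i
  exact (tangentCoordChange_comp (I := 𝓡 4) ⟨⟨hx, hy'⟩, mem_extChartAt_source _⟩).symm

/-- The exterior derivative commutes with the passage to coordinates. -/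
theorem chartForm_extd {p : ℕ} {α : Form M p}
    (hα : ∀ x₀ : M, DifferentiableOn ℝ (chartForm α x₀) (extChartAt (𝓡 4) x₀).target)
    (x₀ : M) {y : E4} (hy : y ∈ (extChartAt (𝓡 4) x₀).target) :
    chartForm (extd α) x₀ y = extDeriv (chartForm α x₀) y := by
  set x := (extChartAt (𝓡 4) x₀).symm y with hxdef
  set t := extChartAt (𝓡 4) x ∘ (extChartAt (𝓡 4) x₀).symm with ht
  have hty : t y = base x := rfl
  have hx₀ : x ∈ (extChartAt (𝓡 4) x₀).source := (extChartAt (𝓡 4) x₀).map_target hy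
  have hd : chartDiff x₀ y = fderiv ℝ t y := by
    rw [chartDiff_eq x₀ hy, tangentCoordChange_eq_fderiv, (extChartAt (𝓡 4) x₀).right_inv hy]
  have hmem : y ∈ ((extChartAt (𝓡 4) x₀).symm ≫ extChartAt (𝓡 4) x).source := by
    rw [PartialEquiv.trans_source]
    exact ⟨hy, by exact mem_extChartAt_source x⟩
  have hts : ContDiffAt ℝ ∞ t y := by
    have := contDiffWithinAt_ext_coord_change (I := 𝓡 4) (n := ∞) x x₀ hmem
    rwa [range_model, contDiffWithinAt_univ] at this
  -- Near y the expression in the chart at x₀ is the pullback, by the transition map t, of the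
  -- expression in the preferred chart at x, the chart in which `extd` is evaluated at x. The claim
  -- is then naturality of d under pullback.
  have hev : chartForm α x₀ =ᶠ[nhds y]
      fun z => (chartForm α x (t z)).compContinuousLinearMap (fderiv ℝ t z) := by
    have h1 : ∀ᶠ z in nhds y, z ∈ (extChartAt (𝓡 4) x₀).target :=
      (isOpen_chart_target x₀).mem_nhds hy
    have h2 : ∀ᶠ z in nhds y, (extChartAt (𝓡 4) x₀).symm z ∈ (extChartAt (𝓡 4) x).source :=
      (continuousAt_extChartAt_symm'' hy).preimage_mem_nhds (extChartAt_source_mem_nhds x)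
    filter_upwards [h1, h2] with z hz hz'
    exact chartForm_change α x₀ x hz hz'
  rw [hev.extDeriv_eq, extDeriv_pullback (r := ∞) _ hts two_le_infty, chartForm, hd]
  · rfl
  · rw [hty]
    exact (hα x).differentiableAt ((isOpen_chart_target x).mem_nhds (base_mem_target x))

end Komar

namespace Komar

/-! ### Components of alternating forms -/

theorem repr_e (v : E4) : v = ∑ i, v i • e i := by
  have := (EuclideanSpace.basisFun (Fin 4) ℝ).sum_repr v
  simpa [e] using this.symm

@[simp] theorem e_apply (i j : Fin 4) : e i j = if j = i then 1 else 0 := by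
  simp [e]

/-- Alternating forms are determined by their components. -/
theorem form_ext {p : ℕ} {α β : E4 [⋀^Fin p]→L[ℝ] ℝ}
    (h : ∀ a : Fin p → Fin 4, α (fun i => e (a i)) = β (fun i => e (a i))) : α = β := by
  refine ContinuousAlternatingMap.toAlternatingMap_injective
    (AlternatingMap.coe_multilinearMap_injective ?_)
  refine Module.Basis.ext_multilinear
    (fun _ => (EuclideanSpace.basisFun (Fin 4) ℝ).toBasis) fun a => ?_
  simpa [e] using h a

/-- The components of an alternating form. -/
def components (p : ℕ) : (E4 [⋀^Fin p]→L[ℝ] ℝ) →L[ℝ] ((Fin p → Fin 4) → ℝ) :=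
  ContinuousLinearMap.pi fun a => ContinuousAlternatingMap.apply ℝ E4 ℝ (fun i => e (a i))

/-- A linear left inverse, continuous by finite dimension, transfers smoothness from components to
the form as a map into a normed space. -/
theorem exists_ofComponents (p : ℕ) :
    ∃ L : ((Fin p → Fin 4) → ℝ) →L[ℝ] (E4 [⋀^Fin p]→L[ℝ] ℝ), ∀ α, L (components p α) = α := by
  obtain ⟨g, hg⟩ := (components p).toLinearMap.exists_leftInverse_of_injective
    (LinearMap.ker_eq_bot.2 fun α β h => form_ext fun a => congrFun h a)
  exact ⟨LinearMap.toContinuousLinearMap g, fun α => LinearMap.congr_fun hg α⟩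

theorem contDiffOn_form {p : ℕ} {α : E4 → E4 [⋀^Fin p]→L[ℝ] ℝ} {s : Set E4}
    (h : ∀ a : Fin p → Fin 4, ContDiffOn ℝ ∞ (fun y => α y (fun i => e (a i))) s) :
    ContDiffOn ℝ ∞ α s := by
  obtain ⟨L, hL⟩ := exists_ofComponents p
  have h1 : ContDiffOn ℝ ∞ (fun y => components p (α y)) s := contDiffOn_pi.2 h
  exact (L.contDiff.comp_contDiffOn h1).congr fun y _ => (hL _).symm

theorem contDiffOn_components {p : ℕ} {α : E4 → E4 [⋀^Fin p]→L[ℝ] ℝ} {s : Set E4}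
    (h : ContDiffOn ℝ ∞ α s) (v : Fin p → E4) : ContDiffOn ℝ ∞ (fun y => α y v) s :=
  (ContinuousAlternatingMap.apply ℝ E4 ℝ v).contDiff.comp_contDiffOn h

variable {M : Type*} [TopologicalSpace M] [ChartedSpace E4 M]

theorem SmoothForm.differentiableOn {p : ℕ} {α : Form M p} (hα : SmoothForm α) (x₀ : M) :
    DifferentiableOn ℝ (chartForm α x₀) (extChartAt (𝓡 4) x₀).target :=
  (hα x₀).differentiableOn (by simp)

theorem contDiffOn_extDeriv {p : ℕ} {α : E4 → E4 [⋀^Fin p]→L[ℝ] ℝ} {s : Set E4} (hs : IsOpen s)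
    (h : ContDiffOn ℝ ∞ α s) : ContDiffOn ℝ ∞ (extDeriv α) s :=
  (ContinuousAlternatingMap.alternatizeUncurryFinCLM ℝ E4 ℝ).contDiff.comp_contDiffOn
    (h.fderiv_of_isOpen hs (by simp))

variable [IsManifold (𝓡 4) ∞ M]

theorem SmoothForm.extd {p : ℕ} {α : Form M p} (hα : SmoothForm α) : SmoothForm (extd α) :=
  fun x₀ => (contDiffOn_extDeriv (isOpen_chart_target x₀) (hα x₀)).congr fun _ hy =>
    chartForm_extd hα.differentiableOn x₀ hy

theorem chartForm_extd_eventuallyEq {p : ℕ} {α : Form M p} (hα : SmoothForm α)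
    (x₀ : M) {y : E4} (hy : y ∈ (extChartAt (𝓡 4) x₀).target) :
    chartForm (Komar.extd α) x₀ =ᶠ[nhds y] extDeriv (chartForm α x₀) := by
  filter_upwards [(isOpen_chart_target x₀).mem_nhds hy] with z hz
  exact chartForm_extd hα.differentiableOn x₀ hz

theorem SmoothForm.extd_extd {p : ℕ} {α : Form M p} (hα : SmoothForm α) :
    Komar.extd (Komar.extd α) = 0 := by
  funext x
  have hx := base_mem_target x
  rw [Komar.extd, (chartForm_extd_eventuallyEq hα x hx).extDeriv_eq]
  exact extDeriv_extDeriv_apply ((hα x).contDiffAt ((isOpen_chart_target x).mem_nhds hx))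
    two_le_infty

/-! ### Smooth vector fields -/

theorem SmoothVField.contDiffOn {A : VField M} (hA : SmoothVField A) (x₀ : M) :
    ContDiffOn ℝ ∞ (fun y => chartDiffInv x₀ ((extChartAt (𝓡 4) x₀).symm y)
      (A ((extChartAt (𝓡 4) x₀).symm y))) (extChartAt (𝓡 4) x₀).target := by
  have h1 := ((trivializationAt E4 (TangentSpace (𝓡 4)) x₀).contMDiffOn_section_baseSet_iff
    (IB := 𝓡 4) (n := ∞) (E := TangentSpace (𝓡 4)) (s := A)).1 hA.contMDiffOn
  rw [TangentBundle.trivializationAt_baseSet] at h1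
  have h2 := h1.comp (contMDiffOn_extChartAt_symm x₀) fun y hy => by
    have := (extChartAt (𝓡 4) x₀).map_target hy
    rwa [extChartAt_source] at this
  exact contMDiffOn_iff_contDiffOn.1 h2

/-- A local extension of v is cut off by a bump function supported where the extension is smooth;
the Hausdorff hypothesis enters through these bump functions. -/
theorem exists_smoothVField [T2Space M] (x : M) (v : Tan x) :
    ∃ A : VField M, SmoothVField A ∧ A x = v := by
  obtain ⟨s, hs, hs'⟩ := FiberBundle.exists_contMDiffOn_extend (𝓡 4) E4 (k := ∞)
    (V := TangentSpace (𝓡 4)) (x₀ := x) v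
  obtain ⟨u, hus, huo, hxu⟩ := mem_nhds_iff.1 hs
  obtain ⟨f, hf⟩ := (SmoothBumpFunction.nhds_basis_tsupport (I := 𝓡 4) x).mem_iff.1
    (huo.mem_nhds hxu)
  refine ⟨fun z => f z • FiberBundle.extend E4 (E := TangentSpace (𝓡 4)) v z,
    ContMDiffOn.smul_section_of_tsupport f.contMDiff.contMDiffOn huo hf.2 (hs'.mono hus), ?_⟩
  have h : FiberBundle.extend E4 (E := TangentSpace (𝓡 4)) v x = v :=
    FiberBundle.extend_apply_self E4 (E := TangentSpace (𝓡 4)) v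
  beta_reduce
  rw [f.eq_one, h]
  exact one_smul ℝ v

namespace Spacetime

variable (S : Spacetime M)

theorem chartForm_flat_apply (A : VField M) (x₀ : M) {y : E4}
    (hy : y ∈ (extChartAt (𝓡 4) x₀).target) (j : Fin 4) :
    chartForm (S.flat A) x₀ y (fun _ => e j) =
      ∑ i, chartDiffInv x₀ ((extChartAt (𝓡 4) x₀).symm y) (A ((extChartAt (𝓡 4) x₀).symm y)) i *
        S.gram x₀ y i j := by
  have h := chartDiff_comp_inv x₀ ((extChartAt (𝓡 4) x₀).map_target hy)
    (A ((extChartAt (𝓡 4) x₀).symm y))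
  rw [(extChartAt (𝓡 4) x₀).right_inv hy] at h
  set a := chartDiffInv x₀ ((extChartAt (𝓡 4) x₀).symm y) (A ((extChartAt (𝓡 4) x₀).symm y))
  have : chartForm (S.flat A) x₀ y (fun _ => e j) = S.g ((extChartAt (𝓡 4) x₀).symm y)
      (A ((extChartAt (𝓡 4) x₀).symm y)) (chartDiff x₀ y (e j)) := rfl
  rw [this, ← h]
  conv_lhs => rw [repr_e a]
  simp [gram, -e_apply]

theorem smoothForm_flat {A : VField M} (hA : SmoothVField A) : SmoothForm (S.flat A) := by
  intro x₀
  refine contDiffOn_form fun a => ?_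
  have h := hA.contDiffOn x₀
  refine ContDiffOn.congr (f := fun y => ∑ i, chartDiffInv x₀ ((extChartAt (𝓡 4) x₀).symm y)
    (A ((extChartAt (𝓡 4) x₀).symm y)) i * S.gram x₀ y i (a 0)) ?_ ?_
  · refine ContDiffOn.sum fun i _ => ContDiffOn.mul ?_ (S.smooth_g x₀ i (a 0))
    exact (EuclideanSpace.proj i : E4 →L[ℝ] ℝ).contDiff.comp_contDiffOn h
  · intro y hy
    rw [← S.chartForm_flat_apply A x₀ hy]
    congr 1
    funext i
    rw [Subsingleton.elim i 0]

end Spacetime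

end Komar

namespace Komar

/-! ### Algebra of the Hodge star -/

/-- The vector `G a b • e b`, obtained by raising the index of the covector `dxᵃ`. -/
def raise (G : Matrix (Fin 4) (Fin 4) ℝ) (a : Fin 4) : E4 := ∑ b, G a b • e b

theorem multilinear_expand {p : ℕ} {X : Type*} [AddCommGroup X] [Module ℝ X]
    (f : MultilinearMap ℝ (fun _ : Fin p => E4) X) (N : Fin p → Fin 4 → ℝ) (u : Fin 4 → E4) :
    f (fun i => ∑ c, N i c • u c) =
      ∑ c : Fin p → Fin 4, (∏ i, N i (c i)) • f (fun i => u (c i)) := by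
  rw [MultilinearMap.map_sum]
  exact Finset.sum_congr rfl fun c _ => f.map_smul_univ _ _

/-- `insertFirst` as a multilinear map of the inserted vectors. -/
def insertMulti {p q : ℕ} (h : p + q = 4) (τ : E4 [⋀^Fin 4]→L[ℝ] ℝ) :
    MultilinearMap ℝ (fun _ : Fin p => E4) (MultilinearMap ℝ (fun _ : Fin q => E4) ℝ) :=
  (τ.toMultilinearMap.domDomCongr ((finCongr h.symm).trans finSumFinEquiv.symm)).currySum

theorem insertMulti_apply {p q : ℕ} (h : p + q = 4) (τ : E4 [⋀^Fin 4]→L[ℝ] ℝ) (u : Fin p → E4)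
    (w : Fin q → E4) : insertMulti h τ u w = insertFirst h u τ w := by
  rw [insertMulti, MultilinearMap.currySum_apply]
  change τ _ = τ _
  congr 1

/-- By multilinearity the factors of the inverse metric are absorbed into the inserted vectors,
which removes the sum over b. -/
theorem hodge_apply {p q : ℕ} (h : p + q = 4) (G : Matrix (Fin 4) (Fin 4) ℝ)
    (τ : E4 [⋀^Fin 4]→L[ℝ] ℝ) (α : E4 [⋀^Fin p]→L[ℝ] ℝ) (w : Fin q → E4) :
    hodge h G τ α w = (p.factorial : ℝ)⁻¹ * ∑ a : Fin p → Fin 4,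
      α (fun i => e (a i)) * insertFirst h (fun i => raise G (a i)) τ w := by
  simp only [hodge, ContinuousAlternatingMap.smul_apply, ContinuousAlternatingMap.sum_apply,
    smul_eq_mul]
  congr 1
  refine Finset.sum_congr rfl fun a _ => ?_
  rw [← insertMulti_apply]
  simp only [raise]
  rw [multilinear_expand, sum_apply, Finset.mul_sum]
  refine Finset.sum_congr rfl fun b _ => ?_
  rw [smul_apply, insertMulti_apply, smul_eq_mul, mul_assoc]

/-- The matrix of an endomorphism of `ℝ⁴`. -/
def mat (L : E4 →L[ℝ] E4) : Matrix (Fin 4) (Fin 4) ℝ := Matrix.of fun c a => L (e a) c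

theorem map_e (L : E4 →L[ℝ] E4) (a : Fin 4) : L (e a) = ∑ c, mat L c a • e c := repr_e _

theorem map_raise (L : E4 →L[ℝ] E4) (G : Matrix (Fin 4) (Fin 4) ℝ) (a : Fin 4) :
    L (raise G a) = raise (G * (mat L).transpose) a := by
  simp only [raise, map_sum, map_smul, map_e L, Finset.smul_sum, Matrix.mul_apply,
    Matrix.transpose_apply, Finset.sum_smul, mul_smul]
  exact Finset.sum_comm

/-- Naturality of the Hodge star. -/
theorem hodge_comp {p q : ℕ} (h : p + q = 4) {G G' : Matrix (Fin 4) (Fin 4) ℝ} (L : E4 →L[ℝ] E4)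
    (hG : mat L * G' * (mat L).transpose = G) (τ : E4 [⋀^Fin 4]→L[ℝ] ℝ)
    (α : E4 [⋀^Fin p]→L[ℝ] ℝ) :
    hodge h G' (τ.compContinuousLinearMap L) (α.compContinuousLinearMap L) =
      (hodge h G τ α).compContinuousLinearMap L := by
  ext w
  rw [ContinuousAlternatingMap.compContinuousLinearMap_apply, hodge_apply, hodge_apply]
  congr 1
  have h1 : ∀ a : Fin p → Fin 4, α.compContinuousLinearMap L (fun i => e (a i)) =
      ∑ c : Fin p → Fin 4, (∏ i, mat L (c i) (a i)) * α (fun i => e (c i)) := by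
    intro a
    have := multilinear_expand α.toMultilinearMap (fun i c => mat L c (a i)) e
    simp only [← map_e] at this
    exact this
  have h2 : ∀ a : Fin p → Fin 4, insertFirst h (fun i => raise G' (a i))
      (τ.compContinuousLinearMap L) w = insertMulti h τ (fun i => L (raise G' (a i))) (L ∘ w) := by
    intro a
    rw [insertMulti_apply]
    change τ _ = τ _
    congr 1
    funext i
    simp only [Function.comp_apply]
    rcases ((finCongr h.symm).trans finSumFinEquiv.symm) i with a | b <;> rfl
  -- The only use of the congruence `hG`: L carries the vectors raised by G' to those raised by G.
  have h3 : ∀ c, raise G c = ∑ a, mat L c a • L (raise G' a) := by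
    intro c
    simp only [map_raise]
    simp only [raise, Finset.smul_sum, smul_smul]
    rw [Finset.sum_comm]
    simp only [← Finset.sum_smul, ← Matrix.mul_apply, ← Matrix.mul_assoc, hG]
  simp only [h1, h2, Finset.sum_mul]
  rw [Finset.sum_comm]
  refine Finset.sum_congr rfl fun c _ => ?_
  rw [← insertMulti_apply]
  simp only [h3]
  rw [multilinear_expand, sum_apply, Finset.mul_sum]
  refine Finset.sum_congr rfl fun a _ => ?_
  rw [smul_apply, smul_eq_mul]
  simp only [Function.comp_def]
  ring

theorem form_four_apply (τ : E4 [⋀^Fin 4]→L[ℝ] ℝ) (v : Fin 4 → E4) :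
    τ v = τ e * (Matrix.of fun c i => v i c).det := by
  have := τ.toAlternatingMap.eq_smul_basis_det (EuclideanSpace.basisFun (Fin 4) ℝ).toBasis
  have h1 := congrArg (fun f => f v) this
  have h2 : (⇑(EuclideanSpace.basisFun (Fin 4) ℝ).toBasis : Fin 4 → E4) = e := by
    funext i; simp [e]
  simp only [AlternatingMap.smul_apply, smul_eq_mul, h2, Module.Basis.det_apply] at h1
  exact h1

/-- Raising all four indices at once costs a determinant; this is the source of det G in ⋆⋆. -/
theorem form_four_map (τ : E4 [⋀^Fin 4]→L[ℝ] ℝ) (N : Matrix (Fin 4) (Fin 4) ℝ) (v : Fin 4 → Fin 4) :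
    τ (fun i => raise N (v i)) = N.det * τ (fun i => e (v i)) := by
  rw [form_four_apply τ fun i => raise N (v i), form_four_apply τ fun i => e (v i)]
  have : (Matrix.of fun c i => raise N (v i) c) =
      N.transpose * (Matrix.of fun c i => e (v i) c) := by
    ext c i
    simp [raise, Matrix.mul_apply]
  rw [this, Matrix.det_mul, Matrix.det_transpose]
  ring

/-- Squaring kills the sign of the permutation, so the contractions of τ with itself reduce to
counting injective multi-indices. -/
theorem form_four_sq (τ : E4 [⋀^Fin 4]→L[ℝ] ℝ) (v : Fin 4 → Fin 4) :
    τ (fun i => e (v i)) ^ 2 = if Function.Injective v then τ e ^ 2 else 0 := by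
  split_ifs with hv
  · have hb := (Finite.injective_iff_bijective.1 hv)
    have := τ.toAlternatingMap.map_perm e (Equiv.ofBijective v hb)
    have h2 : τ (fun i => e (v i)) = Equiv.Perm.sign (Equiv.ofBijective v hb) • τ e := this
    rw [h2]
    rcases Int.units_eq_one_or (Equiv.Perm.sign (Equiv.ofBijective v hb)) with h | h <;> simp [h]
  · simp only [Function.Injective, not_forall] at hv
    obtain ⟨i, j, hij, hne⟩ := hv
    rw [τ.map_eq_zero_of_eq _ (i := i) (j := j) (by simp [hij]) hne]
    simp

theorem sum_form_four_sq (τ : E4 [⋀^Fin 4]→L[ℝ] ℝ) :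
    ∑ a : Fin 4 → Fin 4, τ (fun i => e (a i)) ^ 2 = 24 * τ e ^ 2 := by
  simp only [form_four_sq, Finset.sum_ite, Finset.sum_const_zero, add_zero, Finset.sum_const,
    nsmul_eq_mul]
  have : (Finset.univ.filter fun a : Fin 4 → Fin 4 => Function.Injective a).card = 24 := by
    decide +kernel
  rw [this]
  norm_num

/-- Both factors are nonzero only if l and k are the one index missing from a; there are 3!
orderings of the other three. -/
theorem sum_form_four_cons (τ : E4 [⋀^Fin 4]→L[ℝ] ℝ) (k l : Fin 4) :
    ∑ a : Fin 3 → Fin 4, τ ![e l, e (a 0), e (a 1), e (a 2)] * τ ![e k, e (a 0), e (a 1), e (a 2)] =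
      if l = k then 6 * τ e ^ 2 else 0 := by
  have hv : ∀ (m : Fin 4) (a : Fin 3 → Fin 4), ![e m, e (a 0), e (a 1), e (a 2)] =
      fun i => e (![m, a 0, a 1, a 2] i) := by
    intro m a
    funext i
    fin_cases i <;> rfl
  simp only [hv]
  split_ifs with hlk
  · subst hlk
    simp only [← pow_two, form_four_sq, Finset.sum_ite, Finset.sum_const_zero, add_zero,
      Finset.sum_const, nsmul_eq_mul]
    have : (Finset.univ.filter fun a : Fin 3 → Fin 4 =>
        Function.Injective ![l, a 0, a 1, a 2]).card = 6 := by
      revert l; decide +kernel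
    rw [this]
    norm_num
  · refine Finset.sum_eq_zero fun a _ => ?_
    have : ¬ Function.Injective ![l, a 0, a 1, a 2] ∨ ¬ Function.Injective ![k, a 0, a 1, a 2] := by
      revert hlk; revert l k a; decide +kernel
    rcases this with h | h
    · have h2 := form_four_sq τ ![l, a 0, a 1, a 2]
      rw [if_neg h] at h2
      rw [pow_eq_zero_iff two_ne_zero |>.1 h2, zero_mul]
    · have h2 := form_four_sq τ ![k, a 0, a 1, a 2]
      rw [if_neg h] at h2
      rw [pow_eq_zero_iff two_ne_zero |>.1 h2, mul_zero]

theorem insertFirst_zero_four (u : Fin 0 → E4) (τ : E4 [⋀^Fin 4]→L[ℝ] ℝ) (h : 0 + 4 = 4) :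
    insertFirst h u τ = τ := by
  ext w
  change τ _ = τ w
  congr 1
  funext i
  fin_cases i <;> rfl

theorem insertFirst_four_zero (u : Fin 4 → E4) (τ : E4 [⋀^Fin 4]→L[ℝ] ℝ) (h : 4 + 0 = 4)
    (w : Fin 0 → E4) : insertFirst h u τ w = τ u := by
  change τ _ = τ u
  congr 1
  funext i
  fin_cases i <;> rfl

theorem insertFirst_one_three (u : Fin 1 → E4) (τ : E4 [⋀^Fin 4]→L[ℝ] ℝ) (h : 1 + 3 = 4)
    (w : Fin 3 → E4) : insertFirst h u τ w = τ ![u 0, w 0, w 1, w 2] := by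
  change τ _ = τ _
  congr 1
  funext i
  fin_cases i <;> rfl

theorem insertFirst_two_two (u : Fin 2 → E4) (τ : E4 [⋀^Fin 4]→L[ℝ] ℝ) (h : 2 + 2 = 4)
    (w : Fin 2 → E4) : insertFirst h u τ w = τ ![u 0, u 1, w 0, w 1] := by
  change τ _ = τ _
  congr 1
  funext i
  fin_cases i <;> rfl

theorem insertFirst_three_one (u : Fin 3 → E4) (τ : E4 [⋀^Fin 4]→L[ℝ] ℝ) (h : 3 + 1 = 4)
    (w : Fin 1 → E4) : insertFirst h u τ w = τ ![u 0, u 1, u 2, w 0] := by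
  change τ _ = τ _
  congr 1
  funext i
  fin_cases i <;> rfl

/-- Summation over `Fin 1 → Fin 4`. -/
theorem sum_fin_one {X : Type*} [AddCommMonoid X] (f : (Fin 1 → Fin 4) → X) :
    ∑ a, f a = ∑ i, f (fun _ => i) :=
  Fintype.sum_equiv (Equiv.funUnique (Fin 1) (Fin 4)) _ _ fun a => by
    congr 1; funext i; rw [Subsingleton.elim i default]; rfl

theorem hodge_zero_four (h : 0 + 4 = 4) (G : Matrix (Fin 4) (Fin 4) ℝ)
    (τ : E4 [⋀^Fin 4]→L[ℝ] ℝ) (α : E4 [⋀^Fin 0]→L[ℝ] ℝ) :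
    hodge h G τ α = α ![] • τ := by
  ext w
  rw [hodge_apply]
  simp only [insertFirst_zero_four, Finset.univ_unique, Finset.sum_singleton, Nat.factorial_zero,
    Nat.cast_one, inv_one, one_mul, ContinuousAlternatingMap.smul_apply, smul_eq_mul]
  congr 2
  exact Subsingleton.elim _ _

theorem hodge_one_three (h : 1 + 3 = 4) (G : Matrix (Fin 4) (Fin 4) ℝ)
    (τ : E4 [⋀^Fin 4]→L[ℝ] ℝ) (α : E4 [⋀^Fin 1]→L[ℝ] ℝ) (w : Fin 3 → E4) :
    hodge h G τ α w = ∑ c, α (fun _ => e c) * τ ![raise G c, w 0, w 1, w 2] := by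
  rw [hodge_apply, sum_fin_one]
  simp [insertFirst_one_three]

/-- The 4! multi-indices cancel the factorial in the star, leaving τ(e)² det G. The hypothesis `hτ`
combines unit volume with Lorentzian signature, and it gives the sign −1. -/
theorem hodge_hodge_zero (h : 0 + 4 = 4) (h' : 4 + 0 = 4) (G : Matrix (Fin 4) (Fin 4) ℝ)
    (τ : E4 [⋀^Fin 4]→L[ℝ] ℝ) (hτ : τ e ^ 2 * G.det = -1) (α : E4 [⋀^Fin 0]→L[ℝ] ℝ) :
    hodge h' G τ (hodge h G τ α) = -α := by
  ext w
  rw [hodge_zero_four, hodge_apply]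
  simp only [insertFirst_four_zero, form_four_map, ContinuousAlternatingMap.smul_apply, smul_eq_mul,
    ContinuousAlternatingMap.neg_apply]
  have : ∑ a : Fin 4 → Fin 4, α ![] * τ (fun i => e (a i)) * (G.det * τ fun i => e (a i)) =
      α ![] * G.det * ∑ a : Fin 4 → Fin 4, τ (fun i => e (a i)) ^ 2 := by
    rw [Finset.mul_sum]
    exact Finset.sum_congr rfl fun a _ => by ring
  rw [this, sum_form_four_sq, Subsingleton.elim w ![], show Nat.factorial 4 = 24 from rfl]
  linear_combination α ![] * hτ

theorem raise_lower {g G : Matrix (Fin 4) (Fin 4) ℝ} (hg : g * G = 1) (d : Fin 4) :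
    e d = ∑ k, g d k • raise G k := by
  simp only [raise, Finset.smul_sum, smul_smul]
  rw [Finset.sum_comm]
  simp only [← Finset.sum_smul, ← Matrix.mul_apply, hg, Matrix.one_apply, ite_smul, one_smul,
    zero_smul, Finset.sum_ite_eq, Finset.mem_univ, if_true]

theorem form_four_update_first (τ : E4 [⋀^Fin 4]→L[ℝ] ℝ) (N : Fin 4 → ℝ) (u : Fin 4 → E4)
    (w₁ w₂ w₃ : E4) :
    τ ![∑ k, N k • u k, w₁, w₂, w₃] = ∑ k, N k * τ ![u k, w₁, w₂, w₃] := by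
  have h : ∀ v : E4, τ ![v, w₁, w₂, w₃] = τ.toMultilinearMap.toLinearMap ![0, w₁, w₂, w₃] 0 v := by
    intro v
    rw [MultilinearMap.toLinearMap_apply]
    change τ _ = τ _
    congr 1
    funext i
    fin_cases i <;> rfl
  simp only [h, map_sum, map_smul, smul_eq_mul]

/-- A 4-cycle is odd. This sign is why ⋆⋆ is +1 on one-forms but −1 on functions. -/
theorem form_four_rotate (τ : E4 [⋀^Fin 4]→L[ℝ] ℝ) (w₀ w₁ w₂ w₃ : E4) :
    τ ![w₁, w₂, w₃, w₀] = - τ ![w₀, w₁, w₂, w₃] := by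
  have := τ.toAlternatingMap.map_perm ![w₀, w₁, w₂, w₃] (finRotate 4)
  have hs : Equiv.Perm.sign (finRotate 4) = -1 := by decide
  rw [hs] at this
  have h2 : (![w₀, w₁, w₂, w₃] ∘ finRotate 4) = ![w₁, w₂, w₃, w₀] := by
    funext i
    fin_cases i <;> rfl
  rw [h2] at this
  simpa using this

/-- Writing the free vector as a combination of raised ones makes all four arguments of the outer τ
raised, so det G factors out and a contraction over three indices remains. The sign of the rotation
cancels that of τ(e)² det G, and 3! cancels the factorial. -/
theorem hodge_hodge_one (h : 1 + 3 = 4) (h' : 3 + 1 = 4) {g G : Matrix (Fin 4) (Fin 4) ℝ}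
    (hg : g * G = 1) (hsymm : g.transpose = g)
    (τ : E4 [⋀^Fin 4]→L[ℝ] ℝ) (hτ : τ e ^ 2 * G.det = -1) (β : E4 [⋀^Fin 1]→L[ℝ] ℝ) :
    hodge h' G τ (hodge h G τ β) = β := by
  refine form_ext fun d => ?_
  have hd : (fun i => e (d i)) = fun _ => e (d 0) := by
    funext i; rw [Subsingleton.elim i 0]
  rw [hd]
  generalize d 0 = d
  rw [hodge_apply]
  simp only [insertFirst_three_one, hodge_one_three]
  have h1 : ∀ a : Fin 3 → Fin 4, τ ![raise G (a 0), raise G (a 1), raise G (a 2), e d] =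
      - ∑ k, g d k * (G.det * τ ![e k, e (a 0), e (a 1), e (a 2)]) := by
    intro a
    rw [form_four_rotate, raise_lower hg d, form_four_update_first]
    congr 1
    refine Finset.sum_congr rfl fun k _ => ?_
    congr 1
    have h3 := form_four_map τ G ![k, a 0, a 1, a 2]
    convert h3 using 2
    · funext i; fin_cases i <;> rfl
    · congr 1; funext i; fin_cases i <;> rfl
  have h2 : ∀ (a : Fin 3 → Fin 4) (c : Fin 4), τ ![raise G c, e (a 0), e (a 1), e (a 2)] =
      ∑ l, G c l * τ ![e l, e (a 0), e (a 1), e (a 2)] := fun a c =>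
    form_four_update_first τ _ _ _ _ _
  simp only [h1, h2]
  have h4 : ∑ a : Fin 3 → Fin 4, (∑ c, (β fun _ => e c) * ∑ l, G c l *
        τ ![e l, e (a 0), e (a 1), e (a 2)]) *
        (-∑ k, g d k * (G.det * τ ![e k, e (a 0), e (a 1), e (a 2)])) =
      -G.det * ∑ c, ∑ l, ∑ k, (β fun _ => e c) * G c l * g d k *
        ∑ a : Fin 3 → Fin 4, τ ![e l, e (a 0), e (a 1), e (a 2)] *
          τ ![e k, e (a 0), e (a 1), e (a 2)] := by
    have : ∀ a : Fin 3 → Fin 4, (∑ c, (β fun _ => e c) * ∑ l, G c l *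
        τ ![e l, e (a 0), e (a 1), e (a 2)]) *
        (-∑ k, g d k * (G.det * τ ![e k, e (a 0), e (a 1), e (a 2)])) =
        ∑ c, ∑ l, ∑ k, -G.det * ((β fun _ => e c) * G c l * g d k *
          (τ ![e l, e (a 0), e (a 1), e (a 2)] * τ ![e k, e (a 0), e (a 1), e (a 2)])) := by
      intro a
      rw [Finset.sum_mul]
      refine Finset.sum_congr rfl fun c _ => ?_
      rw [Finset.mul_sum, Finset.sum_mul]
      refine Finset.sum_congr rfl fun l _ => ?_
      rw [mul_neg, Finset.mul_sum, ← Finset.sum_neg_distrib]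
      refine Finset.sum_congr rfl fun k _ => ?_
      ring
    rw [Finset.sum_congr rfl fun a _ => this a]
    simp only [Finset.mul_sum]
    rw [Finset.sum_comm]
    refine Finset.sum_congr rfl fun c _ => ?_
    rw [Finset.sum_comm]
    refine Finset.sum_congr rfl fun l _ => ?_
    rw [Finset.sum_comm]
  rw [h4]
  simp only [sum_form_four_cons, mul_ite, mul_zero, Finset.sum_ite_eq, Finset.mem_univ, if_true]
  have h5 : ∀ c l, (β fun _ => e c) * G c l * g d l * (6 * τ e ^ 2) =
      6 * τ e ^ 2 * ((β fun _ => e c) * (G c l * g l d)) := by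
    intro c l
    rw [show g d l = g l d from congrFun (congrFun hsymm l) d]
    ring
  simp only [h5, ← Finset.mul_sum, ← Matrix.mul_apply, mul_eq_one_comm.1 hg, Matrix.one_apply,
    mul_ite, mul_one, mul_zero, Finset.sum_ite_eq', Finset.mem_univ, if_true]
  rw [show Nat.factorial 3 = 6 from rfl]
  push_cast
  linear_combination -(β fun _ => e d) * hτ

end Komar

/-! ### The metric, the volume form and the Hodge star in a chart -/

namespace Komar

theorem contDiffOn_det {n : ℕ} {A : E4 → Matrix (Fin n) (Fin n) ℝ} {s : Set E4}
    (h : ∀ i j, ContDiffOn ℝ ∞ (fun y => A y i j) s) : ContDiffOn ℝ ∞ (fun y => (A y).det) s := by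
  simp only [Matrix.det_apply, Units.smul_def, zsmul_eq_mul]
  exact ContDiffOn.sum fun σ _ => contDiffOn_const.mul (contDiffOn_prod fun i _ => h _ _)

theorem contDiffOn_inv {n : ℕ} {A : E4 → Matrix (Fin n) (Fin n) ℝ} {s : Set E4}
    (h : ∀ i j, ContDiffOn ℝ ∞ (fun y => A y i j) s) (h0 : ∀ y ∈ s, (A y).det ≠ 0)
    (i j : Fin n) : ContDiffOn ℝ ∞ (fun y => (A y)⁻¹ i j) s := by
  simp only [Matrix.inv_def, Matrix.smul_apply, smul_eq_mul, Ring.inverse_eq_inv,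
    Matrix.adjugate_apply]
  refine ((contDiffOn_det h).inv h0).mul (contDiffOn_det fun k l => ?_)
  by_cases hk : k = j
  · subst hk
    simp only [Matrix.updateRow_self]
    exact contDiffOn_const
  · simp only [Matrix.updateRow_ne hk]
    exact h k l

theorem contDiffOn_hodge {p q : ℕ} (h : p + q = 4) {G : E4 → Matrix (Fin 4) (Fin 4) ℝ}
    {τ : E4 → E4 [⋀^Fin 4]→L[ℝ] ℝ} {α : E4 → E4 [⋀^Fin p]→L[ℝ] ℝ} {s : Set E4}
    (hG : ∀ i j, ContDiffOn ℝ ∞ (fun y => G y i j) s) (hτ : ContDiffOn ℝ ∞ τ s)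
    (hα : ContDiffOn ℝ ∞ α s) : ContDiffOn ℝ ∞ (fun y => hodge h (G y) (τ y) (α y)) s := by
  refine contDiffOn_form fun w => ?_
  simp only [hodge, ContinuousAlternatingMap.smul_apply, ContinuousAlternatingMap.sum_apply,
    smul_eq_mul]
  refine contDiffOn_const.mul (ContDiffOn.sum fun a _ => ContDiffOn.sum fun b _ => ?_)
  exact ((contDiffOn_components hα _).mul (contDiffOn_prod fun i _ => hG _ _)).mul
    (contDiffOn_components hτ _)

variable {M : Type*} [TopologicalSpace M] [ChartedSpace E4 M]

namespace Spacetime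

variable (S : Spacetime M)

theorem gram_transpose (x₀ : M) (y : E4) : (S.gram x₀ y).transpose = S.gram x₀ y := by
  ext i j
  exact S.symm _ _ _

theorem gram_symm (x₀ : M) (y : E4) (i j : Fin 4) : S.gram x₀ y i j = S.gram x₀ y j i :=
  S.symm _ _ _

variable [IsManifold (𝓡 4) ∞ M]

theorem gram_base (x : M) (i j : Fin 4) : S.gram x (base x) i j = S.g x (e i) (e j) := by
  rw [gram, Matrix.of_apply, chartDiff_base, chart_symm_base]
  rfl

/-- The matrix of a bilinear form in a system of vectors. -/
theorem bilin_expand (b : E4 →L[ℝ] E4 →L[ℝ] ℝ) (v : Fin 4 → E4) :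
    (Matrix.of fun i j => b (v i) (v j)) = (Matrix.of fun c i => v i c).transpose *
      (Matrix.of fun i j => b (e i) (e j)) * Matrix.of fun c i => v i c := by
  ext i j
  rw [Matrix.of_apply]
  conv_lhs => rw [repr_e (v i), repr_e (v j)]
  simp only [map_sum, map_smul, sum_apply, smul_apply,
    smul_eq_mul, Matrix.mul_apply, Matrix.transpose_apply, Matrix.of_apply]
  refine Finset.sum_congr rfl fun k _ => ?_
  rw [mul_comm]

theorem gram_change (x₀ : M) (y : E4) : S.gram x₀ y = (mat (chartDiff x₀ y)).transpose *
    S.gram ((extChartAt (𝓡 4) x₀).symm y) (base ((extChartAt (𝓡 4) x₀).symm y)) *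
      mat (chartDiff x₀ y) := by
  have := bilin_expand (S.g ((extChartAt (𝓡 4) x₀).symm y)) (fun i => chartDiff x₀ y (e i))
  refine this.trans ?_
  congr 2
  ext i j
  rw [gram_base, Matrix.of_apply]

theorem isUnit_mat_chartDiff {y : E4} (x₀ : M)
    (hy : y ∈ (extChartAt (𝓡 4) x₀).target) : IsUnit (mat (chartDiff x₀ y)) := by
  refine (Matrix.isUnit_iff_isUnit_det _).2 (isUnit_iff_ne_zero.2 fun h0 => ?_)
  obtain ⟨v, hv, hv0⟩ := Matrix.exists_mulVec_eq_zero_iff.2 h0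
  have h1 : chartDiff x₀ y (WithLp.toLp 2 v) = 0 := by
    conv_lhs => rw [repr_e (WithLp.toLp 2 v)]
    ext c
    have := congrFun hv0 c
    simpa [Matrix.mulVec, dotProduct, mat, mul_comm] using this
  have h2 := (chartEquiv x₀ hy).map_eq_zero_iff.1 h1
  exact hv (by simpa using congrArg WithLp.ofLp h2)

/-- Let d be the determinant of an orthonormal basis in the coordinate basis. Then d² det g = −1 and
(τ(e) d)² = 1; dividing by d² gives both claims. -/
theorem gram_base_det_mul_sq (x : M) :
    (S.gram x (base x)).det < 0 ∧ S.τ x e ^ 2 = - (S.gram x (base x)).det := by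
  obtain ⟨b, hb⟩ := S.signature x
  have h1 := bilin_expand (S.g x) b
  have h2 : (Matrix.of fun i j => S.g x (b i) (b j)) = minkowski := by
    ext i j; exact hb i j
  have h3 : (Matrix.of fun i j => S.g x (e i) (e j)) = S.gram x (base x) := by
    ext i j; rw [gram_base, Matrix.of_apply]
  rw [h2, h3] at h1
  have h4 := congrArg Matrix.det h1
  have h5 : minkowski.det = -1 := by
    simp [minkowski, Fin.prod_univ_four]
  rw [Matrix.det_mul, Matrix.det_mul, Matrix.det_transpose, h5] at h4
  have h6 := form_four_apply (S.τ x) b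
  set d := (Matrix.of fun c i => b i c).det
  have h7 : (S.τ x e * d) ^ 2 = 1 := by
    rw [← h6]
    rcases S.τ_unit x b hb with h | h <;> rw [h] <;> norm_num
  have hd : 0 < d ^ 2 := by
    rcases (sq_nonneg d).lt_or_eq with h | h
    · exact h
    · rw [mul_pow, ← h] at h7; norm_num at h7
  constructor
  · by_contra hn
    nlinarith [mul_nonneg hd.le (not_lt.1 hn)]
  · refine mul_right_cancel₀ hd.ne' ?_
    linear_combination h7 - h4

theorem det_gram_neg {y : E4} (x₀ : M)
    (hy : y ∈ (extChartAt (𝓡 4) x₀).target) : (S.gram x₀ y).det < 0 := by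
  have h := congrArg Matrix.det (S.gram_change x₀ y)
  rw [Matrix.det_mul, Matrix.det_mul, Matrix.det_transpose] at h
  have h0 := isUnit_iff_ne_zero.1 ((Matrix.isUnit_iff_isUnit_det _).1 (isUnit_mat_chartDiff x₀ hy))
  rw [h]
  have := (S.gram_base_det_mul_sq ((extChartAt (𝓡 4) x₀).symm y)).1
  have h2 := mul_neg_of_pos_of_neg (pow_pos (abs_pos.2 h0) 2) this
  rw [sq_abs] at h2
  linarith

/-- Both sides scale by the squared determinant of `chartDiff`. No invertibility is needed, so the
identity holds for every y and can be differentiated as an equality of functions. -/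
theorem volume_sq (x₀ : M) (y : E4) : chartForm S.τ x₀ y e ^ 2 = - (S.gram x₀ y).det := by
  have h := congrArg Matrix.det (S.gram_change x₀ y)
  rw [Matrix.det_mul, Matrix.det_mul, Matrix.det_transpose] at h
  have h2 : chartForm S.τ x₀ y e = S.τ _ e * (mat (chartDiff x₀ y)).det :=
    form_four_apply (S.τ ((extChartAt (𝓡 4) x₀).symm y)) fun i => chartDiff x₀ y (e i)
  rw [h2, h, mul_pow, (S.gram_base_det_mul_sq ((extChartAt (𝓡 4) x₀).symm y)).2]
  ring

theorem isUnit_det_gram {y : E4} (x₀ : M)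
    (hy : y ∈ (extChartAt (𝓡 4) x₀).target) : IsUnit (S.gram x₀ y).det :=
  isUnit_iff_ne_zero.2 (S.det_gram_neg x₀ hy).ne

theorem gram_mul_inv {y : E4} (x₀ : M)
    (hy : y ∈ (extChartAt (𝓡 4) x₀).target) : S.gram x₀ y * (S.gram x₀ y)⁻¹ = 1 :=
  Matrix.mul_nonsing_inv _ (S.isUnit_det_gram x₀ hy)

theorem volume_sq_mul {y : E4} (x₀ : M)
    (hy : y ∈ (extChartAt (𝓡 4) x₀).target) : chartForm S.τ x₀ y e ^ 2 * (S.gram x₀ y)⁻¹.det = -1 := by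
  rw [S.volume_sq x₀ y, Matrix.det_nonsing_inv, Ring.inverse_eq_inv, neg_mul,
    mul_inv_cancel₀ (S.det_gram_neg x₀ hy).ne]

theorem inv_gram_change {y : E4} (x₀ : M)
    (hy : y ∈ (extChartAt (𝓡 4) x₀).target) : mat (chartDiff x₀ y) * (S.gram x₀ y)⁻¹ *
    (mat (chartDiff x₀ y)).transpose = S.ginv ((extChartAt (𝓡 4) x₀).symm y) := by
  have hu := (Matrix.isUnit_iff_isUnit_det _).1 (isUnit_mat_chartDiff x₀ hy)
  have hut : IsUnit (mat (chartDiff x₀ y)).transpose.det := by rwa [Matrix.det_transpose]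
  rw [S.gram_change x₀ y, Matrix.mul_inv_rev, Matrix.mul_inv_rev, ginv, ← Matrix.mul_assoc,
    Matrix.mul_nonsing_inv _ hu, Matrix.one_mul, Matrix.mul_assoc, Matrix.nonsing_inv_mul _ hut,
    Matrix.mul_one]

/-- The Hodge star in coordinates. -/
theorem chartForm_star {y : E4} (x₀ : M)
    (hy : y ∈ (extChartAt (𝓡 4) x₀).target) {p q : ℕ} (h : p + q = 4) (α : Form M p) :
    chartForm (S.star h α) x₀ y =
      hodge h (S.gram x₀ y)⁻¹ (chartForm S.τ x₀ y) (chartForm α x₀ y) :=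
  (hodge_comp h (chartDiff x₀ y) (S.inv_gram_change x₀ hy) _ _).symm

theorem starInv_eq {p q : ℕ} (h : p + q = 4) (α : Form M p) (x : M) :
    S.starInv h α x = (-1 : ℝ) ^ (p * q + 1) • S.star h α x := by
  rw [starInv, Real.sign_of_neg (S.gram_base_det_mul_sq x).1, pow_succ]

theorem contDiffOn_inv_gram (x₀ : M) (i j : Fin 4) :
    ContDiffOn ℝ ∞ (fun y => (S.gram x₀ y)⁻¹ i j) (extChartAt (𝓡 4) x₀).target :=
  contDiffOn_inv (S.smooth_g x₀) (fun _ hy => (S.det_gram_neg x₀ hy).ne) i j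

theorem smoothForm_star {p q : ℕ} (h : p + q = 4) {α : Form M p} (hα : SmoothForm α) :
    SmoothForm (S.star h α) := fun x₀ =>
  (contDiffOn_hodge h (S.contDiffOn_inv_gram x₀) (S.smooth_τ x₀) (hα x₀)).congr
    fun _ hy => S.chartForm_star x₀ hy h α

theorem star_star_one (h : 1 + 3 = 4) (h' : 3 + 1 = 4) (β : Form M 1) :
    S.star h' (S.star h β) = β := by
  funext x
  have hx := base_mem_target x
  have h0 := S.volume_sq_mul x hx
  rw [chartForm_base] at h0
  exact hodge_hodge_one h h' (S.gram_mul_inv x hx) (S.gram_transpose x _) _ h0 _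

end Spacetime
end Komar

namespace Komar

/-! ### Partial derivatives -/

theorem pd_add {f g : E4 → ℝ} {y : E4} (i : Fin 4) (hf : DifferentiableAt ℝ f y)
    (hg : DifferentiableAt ℝ g y) : pd i (fun z => f z + g z) y = pd i f y + pd i g y := by
  rw [pd, fderiv_fun_add hf hg]; rfl

theorem pd_sub {f g : E4 → ℝ} {y : E4} (i : Fin 4) (hf : DifferentiableAt ℝ f y)
    (hg : DifferentiableAt ℝ g y) : pd i (fun z => f z - g z) y = pd i f y - pd i g y := by
  rw [pd, fderiv_fun_sub hf hg]; rfl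

theorem pd_mul {f g : E4 → ℝ} {y : E4} (i : Fin 4) (hf : DifferentiableAt ℝ f y)
    (hg : DifferentiableAt ℝ g y) :
    pd i (fun z => f z * g z) y = pd i f y * g y + f y * pd i g y := by
  rw [pd, fderiv_fun_mul hf hg]
  simp only [add_apply, smul_apply, smul_eq_mul, pd]
  ring

theorem pd_const_mul {g : E4 → ℝ} {y : E4} (i : Fin 4) (c : ℝ) (hg : DifferentiableAt ℝ g y) :
    pd i (fun z => c * g z) y = c * pd i g y := by
  rw [pd, fderiv_const_mul hg]; rfl

theorem pd_sum {ι : Type*} {s : Finset ι} {f : ι → E4 → ℝ} {y : E4} (i : Fin 4)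
    (hf : ∀ k ∈ s, DifferentiableAt ℝ (f k) y) :
    pd i (fun z => ∑ k ∈ s, f k z) y = ∑ k ∈ s, pd i (f k) y := by
  rw [pd, fderiv_fun_sum hf, sum_apply]; rfl

theorem pd_congr {F : Type*} [NormedAddCommGroup F] [NormedSpace ℝ F] {f g : E4 → F} {y : E4}
    (i : Fin 4) (h : f =ᶠ[nhds y] g) : pd i f y = pd i g y := by
  rw [pd, pd, h.fderiv_eq]

theorem pd_const {F : Type*} [NormedAddCommGroup F] [NormedSpace ℝ F] (i : Fin 4) (c : F) (y : E4) :
    pd i (fun _ => c) y = 0 := by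
  rw [pd, fderiv_fun_const]; rfl

theorem pd_form_apply {p : ℕ} {α : E4 → E4 [⋀^Fin p]→L[ℝ] ℝ} {y : E4} (i : Fin 4)
    (h : DifferentiableAt ℝ α y) (v : Fin p → E4) : pd i α y v = pd i (fun z => α z v) y := by
  have h2 := ((ContinuousAlternatingMap.apply ℝ E4 ℝ v).hasFDerivAt.comp y h.hasFDerivAt).fderiv
  have h3 : pd i (fun z => α z v) y = fderiv ℝ (ContinuousAlternatingMap.apply ℝ E4 ℝ v ∘ α) y (e i) :=
    rfl
  rw [h3, h2]; rfl

theorem pd_pd_comm {f : E4 → ℝ} {y : E4} (hf : ContDiffAt ℝ ∞ f y) (i j : Fin 4) :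
    pd i (pd j f) y = pd j (pd i f) y := by
  have h1 : DifferentiableAt ℝ (fderiv ℝ f) y :=
    (hf.fderiv_right (m := 1) (WithTop.coe_le_coe.2 le_top)).differentiableAt (by simp)
  have h2 : ∀ k l, pd k (pd l f) y = fderiv ℝ (fderiv ℝ f) y (e k) (e l) := by
    intro k l
    have := (h1.hasFDerivAt.clm_apply (hasFDerivAt_const (e l) y)).fderiv
    rw [pd]
    change fderiv ℝ (fun z => fderiv ℝ f z (e l)) y (e k) = _
    rw [this]
    simp
  rw [h2, h2]
  exact (hf.isSymmSndFDerivAt (by simpa using WithTop.coe_le_coe.2 (le_top : (2 : ℕ∞) ≤ ⊤))) _ _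

theorem contDiffAt_pd {f : E4 → ℝ} {y : E4} (hf : ContDiffAt ℝ ∞ f y) (i : Fin 4) :
    ContDiffAt ℝ ∞ (pd i f) y :=
  (hf.fderiv_right (by simp)).clm_apply contDiffAt_const

/-- The entrywise partial derivative of a matrix of functions. -/
def pdM (i : Fin 4) (A : E4 → Matrix (Fin 4) (Fin 4) ℝ) (y : E4) : Matrix (Fin 4) (Fin 4) ℝ :=
  Matrix.of fun a b => pd i (fun z => A z a b) y

/-- Entrywise smoothness of a matrix of functions. -/
def SmoothMatAt (A : E4 → Matrix (Fin 4) (Fin 4) ℝ) (y : E4) : Prop :=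
  ∀ a b, ContDiffAt ℝ ∞ (fun z => A z a b) y

theorem SmoothMatAt.diff {A : E4 → Matrix (Fin 4) (Fin 4) ℝ} {y : E4} (h : SmoothMatAt A y)
    (a b : Fin 4) : DifferentiableAt ℝ (fun z => A z a b) y :=
  (h a b).differentiableAt (by simp)

theorem SmoothMatAt.mul {A B : E4 → Matrix (Fin 4) (Fin 4) ℝ} {y : E4} (hA : SmoothMatAt A y)
    (hB : SmoothMatAt B y) : SmoothMatAt (fun z => A z * B z) y := fun a b => by
  simp only [Matrix.mul_apply]
  exact ContDiffAt.sum fun c _ => (hA a c).mul (hB c b)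

theorem SmoothMatAt.transpose {A : E4 → Matrix (Fin 4) (Fin 4) ℝ} {y : E4} (hA : SmoothMatAt A y) :
    SmoothMatAt (fun z => (A z).transpose) y := fun a b => hA b a

theorem pdM_mul {A B : E4 → Matrix (Fin 4) (Fin 4) ℝ} {y : E4} (hA : SmoothMatAt A y)
    (hB : SmoothMatAt B y) (i : Fin 4) :
    pdM i (fun z => A z * B z) y = pdM i A y * B y + A y * pdM i B y := by
  ext a b
  simp only [pdM, Matrix.of_apply, Matrix.add_apply, Matrix.mul_apply]
  rw [pd_sum (f := fun c z => A z a c * B z c b) i fun c _ => (hA.diff a c).mul (hB.diff c b), ← Finset.sum_add_distrib]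
  exact Finset.sum_congr rfl fun c _ => pd_mul i (hA.diff a c) (hB.diff c b)

theorem pdM_add {A B : E4 → Matrix (Fin 4) (Fin 4) ℝ} {y : E4} (hA : SmoothMatAt A y)
    (hB : SmoothMatAt B y) (i : Fin 4) :
    pdM i (fun z => A z + B z) y = pdM i A y + pdM i B y := by
  ext a b
  exact pd_add i (hA.diff a b) (hB.diff a b)

theorem pdM_neg (A : E4 → Matrix (Fin 4) (Fin 4) ℝ) (y : E4) (i : Fin 4) :
    pdM i (fun z => -A z) y = -pdM i A y := by
  ext a b
  simp [pdM, pd, fderiv_fun_neg]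

theorem pdM_transpose (A : E4 → Matrix (Fin 4) (Fin 4) ℝ) (y : E4) (i : Fin 4) :
    pdM i (fun z => (A z).transpose) y = (pdM i A y).transpose := rfl

theorem pdM_congr {A B : E4 → Matrix (Fin 4) (Fin 4) ℝ} {y : E4} (h : A =ᶠ[nhds y] B) (i : Fin 4) :
    pdM i A y = pdM i B y := by
  ext a b
  exact pd_congr i (h.mono fun z hz => by simp only [hz])

theorem pdM_pdM_comm {A : E4 → Matrix (Fin 4) (Fin 4) ℝ} {y : E4} (hA : SmoothMatAt A y)
    (i j : Fin 4) : pdM i (pdM j A) y = pdM j (pdM i A) y := by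
  ext a b
  exact pd_pd_comm (hA a b) i j

/-- Jacobi's formula for the derivative of a determinant. -/
theorem pd_det {A : E4 → Matrix (Fin 4) (Fin 4) ℝ} {y : E4} (hA : SmoothMatAt A y) (i : Fin 4) :
    pd i (fun z => (A z).det) y = ((A y).adjugate * pdM i A y).trace := by
  -- By Cramer's rule this diagonal entry is det A with column k replaced by its derivative; it is
  -- expanded over permutations to match the product rule.
  have h1 : ∀ k, ((A y).adjugate * pdM i A y) k k =
      ∑ σ : Equiv.Perm (Fin 4), ((Equiv.Perm.sign σ : ℤ) : ℝ) *
        ((∏ j ∈ Finset.univ.erase k, A y (σ j) j) * pdM i A y (σ k) k) := by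
    intro k
    have : ((A y).adjugate * pdM i A y) k k = (A y).cramer (fun l => pdM i A y l k) k := by
      rw [Matrix.cramer_eq_adjugate_mulVec]; rfl
    rw [this, Matrix.cramer_apply, Matrix.det_apply']
    refine Finset.sum_congr rfl fun σ _ => ?_
    rw [← Finset.prod_erase_mul _ _ (Finset.mem_univ k), Matrix.updateCol_self]
    congr 2
    refine Finset.prod_congr rfl fun j hj => ?_
    rw [Matrix.updateCol_ne (Finset.ne_of_mem_erase hj)]
  simp only [Matrix.trace, Matrix.diag_apply, h1]
  rw [Finset.sum_comm]
  simp only [Matrix.det_apply']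
  have hd : ∀ σ : Equiv.Perm (Fin 4),
      HasFDerivAt (fun z => ∏ j, A z (σ j) j) (∑ k, (∏ j ∈ Finset.univ.erase k, A y (σ j) j) •
        fderiv ℝ (fun z => A z (σ k) k) y) y := fun σ =>
    HasFDerivAt.finsetProd fun j _ => (hA.diff (σ j) j).hasFDerivAt
  rw [pd_sum i fun σ _ => (hd σ).differentiableAt.const_mul _]
  refine Finset.sum_congr rfl fun σ _ => ?_
  rw [pd_const_mul i _ (hd σ).differentiableAt, pd, (hd σ).fderiv, ← Finset.mul_sum]
  simp only [sum_apply, smul_apply, smul_eq_mul]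
  rfl

/-! ### Divergence formulas -/

/-- A `5`-form on `ℝ⁴` vanishes. -/
theorem five_form_eq_zero (α : E4 [⋀^Fin 5]→L[ℝ] ℝ) (v : Fin 5 → E4) : α v = 0 := by
  refine α.toAlternatingMap.map_linearDependent v fun h => ?_
  have := h.fintype_card_le_finrank
  simp at this

/-- The alternating sum is l ∧ τ, a five-form on ℝ⁴. With l the differential of a coefficient, it
trades the exterior derivative for derivatives along the contracted directions. -/
theorem five_term (l : E4 →L[ℝ] ℝ) (τ : E4 [⋀^Fin 4]→L[ℝ] ℝ) (v₀ v₁ v₂ v₃ v₄ : E4) :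
    l v₀ * τ ![v₁, v₂, v₃, v₄] - l v₁ * τ ![v₀, v₂, v₃, v₄] + l v₂ * τ ![v₀, v₁, v₃, v₄]
      - l v₃ * τ ![v₀, v₁, v₂, v₄] + l v₄ * τ ![v₀, v₁, v₂, v₃] = 0 := by
  have h := five_form_eq_zero
    (ContinuousAlternatingMap.alternatizeUncurryFin (l.smulRight τ)) ![v₀, v₁, v₂, v₃, v₄]
  have hr : ∀ i : Fin 5, i.removeNth ![v₀, v₁, v₂, v₃, v₄] =
      ![![v₁, v₂, v₃, v₄], ![v₀, v₂, v₃, v₄], ![v₀, v₁, v₃, v₄], ![v₀, v₁, v₂, v₄],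
        ![v₀, v₁, v₂, v₃]] i := by
    intro i
    funext j
    fin_cases i <;> fin_cases j <;> rfl
  rw [ContinuousAlternatingMap.alternatizeUncurryFin_apply, Fin.sum_univ_five] at h
  simp only [hr] at h
  simp at h
  linarith

/-- The contraction of the first slot. -/
theorem extDeriv_contract_one (τ : E4 [⋀^Fin 4]→L[ℝ] ℝ) (h : 1 + 3 = 4) {P : Fin 4 → E4 → ℝ}
    {y : E4} (hP : ∀ c, DifferentiableAt ℝ (P c) y) :
    extDeriv (fun z => ∑ c, P c z • insertFirst h (fun _ => e c) τ) y = (∑ c, pd c (P c) y) • τ := by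
  have hd : HasFDerivAt (fun z => ∑ c, P c z • insertFirst h (fun _ => e c) τ)
      (∑ c, (fderiv ℝ (P c) y).smulRight (insertFirst h (fun _ => e c) τ)) y :=
    HasFDerivAt.fun_sum fun c _ => (hP c).hasFDerivAt.smul_const (insertFirst h (fun _ => e c) τ)
  ext w
  rw [extDeriv, hd.fderiv, ContinuousAlternatingMap.alternatizeUncurryFin_apply]
  have hr : ∀ i : Fin 4, i.removeNth w =
      ![![w 1, w 2, w 3], ![w 0, w 2, w 3], ![w 0, w 1, w 3], ![w 0, w 1, w 2]] i := by
    intro i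
    funext j
    fin_cases i <;> fin_cases j <;> rfl
  have hw : w = ![w 0, w 1, w 2, w 3] := by
    funext i; fin_cases i <;> rfl
  have h5 := fun c => five_term (fderiv ℝ (P c) y) τ (e c) (w 0) (w 1) (w 2) (w 3)
  rw [ContinuousAlternatingMap.smul_apply, smul_eq_mul, Finset.sum_mul, Fin.sum_univ_four]
  simp only [hr, sum_apply, ContinuousAlternatingMap.sum_apply,
    ContinuousLinearMap.smulRight_apply, ContinuousAlternatingMap.smul_apply,
    insertFirst_one_three, smul_eq_mul, Finset.smul_sum, ← Finset.sum_add_distrib]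
  refine Finset.sum_congr rfl fun c _ => ?_
  conv_rhs => rw [hw]
  have := h5 c
  simp [pd]
  linarith

/-- Of the five terms in `five_term`, three assemble the exterior derivative and two differentiate
along the contracted directions. -/
theorem extDeriv_contract_two (τ : E4 [⋀^Fin 4]→L[ℝ] ℝ) (h : 2 + 2 = 4) (h' : 1 + 3 = 4)
    {P : Fin 4 → Fin 4 → E4 → ℝ} {y : E4} (hP : ∀ c d, DifferentiableAt ℝ (P c d) y) :
    extDeriv (fun z => ∑ c, ∑ d, P c d z • insertFirst h ![e c, e d] τ) y =
      ∑ c, ∑ d, (pd d (P c d) y • insertFirst h' (fun _ => e c) τ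
        - pd c (P c d) y • insertFirst h' (fun _ => e d) τ) := by
  have hd : HasFDerivAt (fun z => ∑ c, ∑ d, P c d z • insertFirst h ![e c, e d] τ)
      (∑ c, ∑ d, (fderiv ℝ (P c d) y).smulRight (insertFirst h ![e c, e d] τ)) y :=
    HasFDerivAt.fun_sum fun c _ => HasFDerivAt.fun_sum fun d _ =>
      (hP c d).hasFDerivAt.smul_const (insertFirst h ![e c, e d] τ)
  ext w
  rw [extDeriv, hd.fderiv, ContinuousAlternatingMap.alternatizeUncurryFin_apply]
  have hr : ∀ i : Fin 3, i.removeNth w = ![![w 1, w 2], ![w 0, w 2], ![w 0, w 1]] i := by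
    intro i
    funext j
    fin_cases i <;> fin_cases j <;> rfl
  rw [Fin.sum_univ_three]
  simp only [hr, sum_apply, ContinuousAlternatingMap.sum_apply,
    ContinuousLinearMap.smulRight_apply, ContinuousAlternatingMap.smul_apply,
    ContinuousAlternatingMap.sub_apply, insertFirst_one_three, insertFirst_two_two, smul_eq_mul,
    Finset.smul_sum, ← Finset.sum_add_distrib]
  refine Finset.sum_congr rfl fun c _ => Finset.sum_congr rfl fun d _ => ?_
  have := five_term (fderiv ℝ (P c d) y) τ (e c) (e d) (w 0) (w 1) (w 2)
  simp [pd]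
  linarith

end Komar

/-! ### The connection: metricity, parallel volume, skew curvature -/

namespace Komar

variable {M : Type*} [TopologicalSpace M] [ChartedSpace E4 M]

namespace Spacetime

variable (S : Spacetime M)

/-- The matrix `Γᵏᵢⱼ` of the connection in the direction `∂ᵢ`. -/
def conn (x₀ : M) (i : Fin 4) (y : E4) : Matrix (Fin 4) (Fin 4) ℝ :=
  Matrix.of fun k j => S.christoffel x₀ k i j y

/-- The curvature endomorphism `[D_{∂ₐ}, D_{∂_b}]` as a matrix. -/
def curv (x₀ : M) (a b : Fin 4) (y : E4) : Matrix (Fin 4) (Fin 4) ℝ :=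
  Matrix.of fun m r => S.riemann x₀ m r a b y

/-- The inverse of the metric matrix. -/
def inv (x₀ : M) (y : E4) : Matrix (Fin 4) (Fin 4) ℝ := (S.gram x₀ y)⁻¹

theorem inv_transpose (x₀ : M) (y : E4) : (S.inv x₀ y).transpose = S.inv x₀ y := by
  rw [inv, Matrix.transpose_nonsing_inv, gram_transpose]

theorem inv_symm (x₀ : M) (y : E4) (i j : Fin 4) : S.inv x₀ y i j = S.inv x₀ y j i :=
  congrFun (congrFun (S.inv_transpose x₀ y) j) i

theorem conn_symm (x₀ : M) (i k j : Fin 4) (y : E4) : S.conn x₀ i y k j = S.conn x₀ j y k i := by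
  simp only [conn, Matrix.of_apply, christoffel]
  congr 1
  refine Finset.sum_congr rfl fun l _ => ?_
  have : (fun z => S.gram x₀ z i j) = fun z => S.gram x₀ z j i := by
    funext z; exact S.gram_symm x₀ z i j
  rw [this]
  ring

theorem curv_eq (x₀ : M) (a b : Fin 4) (y : E4) :
    S.curv x₀ a b y = pdM a (S.conn x₀ b) y - pdM b (S.conn x₀ a) y +
      (S.conn x₀ a y * S.conn x₀ b y - S.conn x₀ b y * S.conn x₀ a y) := by
  ext m r
  simp only [curv, riemann, Matrix.of_apply, Matrix.add_apply, Matrix.sub_apply, Matrix.mul_apply,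
    Finset.sum_sub_distrib]
  rfl

theorem smoothMatAt_gram {y : E4} (x₀ : M) (hy : y ∈ (extChartAt (𝓡 4) x₀).target) :
    SmoothMatAt (S.gram x₀) y := fun i j =>
  (S.smooth_g x₀ i j).contDiffAt ((isOpen_chart_target x₀).mem_nhds hy)

theorem smooth_volume {y : E4} (x₀ : M) (hy : y ∈ (extChartAt (𝓡 4) x₀).target) :
    ContDiffAt ℝ ∞ (fun z => chartForm S.τ x₀ z e) y :=
  (contDiffOn_components (S.smooth_τ x₀) e).contDiffAt ((isOpen_chart_target x₀).mem_nhds hy)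

variable [IsManifold (𝓡 4) ∞ M]

theorem smoothMatAt_inv {y : E4} (x₀ : M) (hy : y ∈ (extChartAt (𝓡 4) x₀).target) :
    SmoothMatAt (S.inv x₀) y := fun i j =>
  (S.contDiffOn_inv_gram x₀ i j).contDiffAt ((isOpen_chart_target x₀).mem_nhds hy)

theorem smoothMatAt_conn {y : E4} (x₀ : M) (hy : y ∈ (extChartAt (𝓡 4) x₀).target) (i : Fin 4) :
    SmoothMatAt (S.conn x₀ i) y := by
  intro k j
  have hg := S.smoothMatAt_gram x₀ hy
  exact contDiffAt_const.mul (ContDiffAt.sum fun l _ => (S.smoothMatAt_inv x₀ hy k l).mul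
    (((contDiffAt_pd (hg j l) i).add (contDiffAt_pd (hg i l) j)).sub (contDiffAt_pd (hg i j) l)))

theorem gram_mul_conn {y : E4} (x₀ : M) (hy : y ∈ (extChartAt (𝓡 4) x₀).target) (i j b : Fin 4) :
    (S.gram x₀ y * S.conn x₀ i y) b j = (1 / 2) * (pd i (fun z => S.gram x₀ z j b) y
      + pd j (fun z => S.gram x₀ z i b) y - pd b (fun z => S.gram x₀ z i j) y) := by
  have h := S.gram_mul_inv x₀ hy
  set D : Fin 4 → ℝ := fun l => pd i (fun z => S.gram x₀ z j l) y
      + pd j (fun z => S.gram x₀ z i l) y - pd l (fun z => S.gram x₀ z i j) y with hD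
  have h1 : (S.gram x₀ y * S.conn x₀ i y) b j =
      (1 / 2) * ∑ l, (S.gram x₀ y * (S.gram x₀ y)⁻¹) b l * D l := by
    simp only [Matrix.mul_apply, Finset.sum_mul, Finset.mul_sum, conn, christoffel, Matrix.of_apply]
    rw [Finset.sum_comm]
    refine Finset.sum_congr rfl fun l _ => Finset.sum_congr rfl fun k _ => ?_
    ring
  rw [h1, h]
  simp [Matrix.one_apply, hD]

/-- The connection is metric. -/
theorem pdM_gram {y : E4} (x₀ : M) (hy : y ∈ (extChartAt (𝓡 4) x₀).target) (i : Fin 4) :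
    pdM i (S.gram x₀) y =
      (S.conn x₀ i y).transpose * S.gram x₀ y + S.gram x₀ y * S.conn x₀ i y := by
  have h : (S.conn x₀ i y).transpose * S.gram x₀ y = (S.gram x₀ y * S.conn x₀ i y).transpose := by
    rw [Matrix.transpose_mul, gram_transpose]
  ext a b
  rw [h, Matrix.add_apply, Matrix.transpose_apply, S.gram_mul_conn x₀ hy, S.gram_mul_conn x₀ hy,
    pdM, Matrix.of_apply]
  have : (fun z => S.gram x₀ z b a) = fun z => S.gram x₀ z a b := by
    funext z; exact S.gram_symm x₀ z b a
  rw [this]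
  ring

theorem inv_mul_gram {y : E4} (x₀ : M) (hy : y ∈ (extChartAt (𝓡 4) x₀).target) :
    S.inv x₀ y * S.gram x₀ y = 1 := mul_eq_one_comm.1 (S.gram_mul_inv x₀ hy)

/-- Differentiate g⁻¹g = 1, insert metricity and multiply by g⁻¹ on the right. -/
theorem pdM_inv {y : E4} (x₀ : M) (hy : y ∈ (extChartAt (𝓡 4) x₀).target) (i : Fin 4) :
    pdM i (S.inv x₀) y =
      -(S.conn x₀ i y * S.inv x₀ y + S.inv x₀ y * (S.conn x₀ i y).transpose) := by
  have h1 := pdM_mul (S.smoothMatAt_inv x₀ hy) (S.smoothMatAt_gram x₀ hy) i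
  have h2 : (fun z => S.inv x₀ z * S.gram x₀ z) =ᶠ[nhds y] fun _ => 1 := by
    filter_upwards [(isOpen_chart_target x₀).mem_nhds hy] with z hz
    exact S.inv_mul_gram x₀ hz
  have h3 : pdM i (fun _ => (1 : Matrix (Fin 4) (Fin 4) ℝ)) y = 0 := by
    ext a b; exact pd_const i _ y
  have h4 : S.gram x₀ y * S.inv x₀ y = 1 := S.gram_mul_inv x₀ hy
  have h6 := S.inv_mul_gram x₀ hy
  rw [pdM_congr h2, h3, S.pdM_gram x₀ hy] at h1
  have h5 := congrArg (· * S.inv x₀ y) h1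
  simp only [Matrix.zero_mul, Matrix.add_mul, Matrix.mul_add, Matrix.mul_assoc, h4,
    Matrix.mul_one] at h5
  rw [← Matrix.mul_assoc (S.inv x₀ y) (S.gram x₀ y), h6, Matrix.one_mul] at h5
  rw [eq_neg_iff_add_eq_zero, h5]
  abel

theorem volume_ne_zero {y : E4} (x₀ : M) (hy : y ∈ (extChartAt (𝓡 4) x₀).target) :
    chartForm S.τ x₀ y e ≠ 0 := fun h => by
  have := S.volume_sq_mul x₀ hy
  rw [h] at this
  norm_num at this

/-- The volume form is parallel. -/
theorem pd_volume {y : E4} (x₀ : M) (hy : y ∈ (extChartAt (𝓡 4) x₀).target) (i : Fin 4) :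
    pd i (fun z => chartForm S.τ x₀ z e) y = chartForm S.τ x₀ y e * (S.conn x₀ i y).trace := by
  have hs := (S.smooth_volume x₀ hy).differentiableAt (by simp)
  have h1 := pd_mul i hs hs
  -- Differentiating τ(e)² = −det g, Jacobi's formula and metricity give the derivative 2 (det g) tr
  -- Γᵢ of det g; then 2τ(e) is cancelled.
  have h2 : (fun z => chartForm S.τ x₀ z e * chartForm S.τ x₀ z e) =
      fun z => (-1) * (S.gram x₀ z).det := by
    funext z
    rw [← sq, S.volume_sq x₀ z]
    ring
  have hg := S.smoothMatAt_gram x₀ hy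
  have hdet : DifferentiableAt ℝ (fun z => (S.gram x₀ z).det) y :=
    ((contDiffOn_det (S.smooth_g x₀)).contDiffAt
      ((isOpen_chart_target x₀).mem_nhds hy)).differentiableAt (by simp)
  rw [h2, pd_const_mul i _ hdet, pd_det hg, S.pdM_gram x₀ hy, Matrix.mul_add, Matrix.trace_add,
    ← Matrix.mul_assoc, Matrix.trace_mul_comm, ← Matrix.mul_assoc, Matrix.mul_adjugate,
    ← Matrix.mul_assoc, Matrix.adjugate_mul, Matrix.smul_mul, Matrix.one_mul, Matrix.trace_smul,
    Matrix.trace_transpose, Matrix.smul_mul, Matrix.one_mul, Matrix.trace_smul, smul_eq_mul] at h1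
  have h3 := S.volume_sq x₀ y
  have h4 := S.volume_ne_zero x₀ hy
  refine mul_left_cancel₀ (mul_ne_zero two_ne_zero h4) ?_
  linear_combination -h1 - 2 * (S.conn x₀ i y).trace * h3

/-- The curvature is skew with respect to the metric. -/
theorem curv_skew {y : E4} (x₀ : M) (hy : y ∈ (extChartAt (𝓡 4) x₀).target) (a b : Fin 4) :
    S.curv x₀ a b y * S.inv x₀ y = -(S.inv x₀ y * (S.curv x₀ a b y).transpose) := by
  -- The mixed second derivatives of g⁻¹ agree. Once both are expanded through metricity, their
  -- difference is the curvature acting on g⁻¹ as a derivation, which therefore vanishes.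
  have key : ∀ a b, pdM a (pdM b (S.inv x₀)) y =
      -((pdM a (S.conn x₀ b) y * S.inv x₀ y + S.conn x₀ b y *
          -(S.conn x₀ a y * S.inv x₀ y + S.inv x₀ y * (S.conn x₀ a y).transpose)) +
        (-(S.conn x₀ a y * S.inv x₀ y + S.inv x₀ y * (S.conn x₀ a y).transpose) *
          (S.conn x₀ b y).transpose + S.inv x₀ y * (pdM a (S.conn x₀ b) y).transpose)) := by
    intro a b
    have hi := S.smoothMatAt_inv x₀ hy
    have hc := S.smoothMatAt_conn x₀ hy b
    have h1 : pdM b (S.inv x₀) =ᶠ[nhds y] fun z =>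
        -(S.conn x₀ b z * S.inv x₀ z + S.inv x₀ z * (S.conn x₀ b z).transpose) := by
      filter_upwards [(isOpen_chart_target x₀).mem_nhds hy] with z hz
      exact S.pdM_inv x₀ hz b
    rw [pdM_congr h1, pdM_neg, pdM_add (hc.mul hi) (hi.mul hc.transpose), pdM_mul hc hi,
      pdM_mul hi hc.transpose, pdM_transpose, S.pdM_inv x₀ hy]
  have h := pdM_pdM_comm (S.smoothMatAt_inv x₀ hy) a b
  rw [key, key, neg_inj] at h
  rw [curv_eq, ← sub_eq_zero]
  rw [← sub_eq_zero] at h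
  rw [← h]
  simp only [Matrix.transpose_add, Matrix.transpose_sub, Matrix.transpose_mul]
  noncomm_ring

end Spacetime
end Komar

/-! ### Covariant derivatives in components and the Ricci identity -/

namespace Komar

variable {M : Type*} [TopologicalSpace M] [ChartedSpace E4 M]

/-- The components of a field of `1`-forms. -/
def comp1 (α : E4 → E4 [⋀^Fin 1]→L[ℝ] ℝ) (j : Fin 4) (y : E4) : ℝ := α y (fun _ => e j)

/-- The components of a field of `2`-forms. -/
def comp2 (β : E4 → E4 [⋀^Fin 2]→L[ℝ] ℝ) (y : E4) : Matrix (Fin 4) (Fin 4) ℝ :=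
  Matrix.of fun i j => β y ![e i, e j]

theorem form_one_sum (α : E4 [⋀^Fin 1]→L[ℝ] ℝ) (c : Fin 4 → ℝ) (u : Fin 4 → E4) :
    α (fun _ => ∑ k, c k • u k) = ∑ k, c k * α (fun _ => u k) := by
  have h : ∀ v : E4, α (fun _ => v) = (ContinuousAlternatingMap.ofSubsingleton ℝ E4 ℝ (0 : Fin 1)).symm α v :=
    fun v => rfl
  simp only [h, map_sum, map_smul, smul_eq_mul]

theorem form_one_ext {α β : E4 [⋀^Fin 1]→L[ℝ] ℝ} (h : ∀ j, α (fun _ => e j) = β (fun _ => e j)) :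
    α = β := form_ext fun a => by
  have : (fun i => e (a i)) = fun _ => e (a 0) := by
    funext i; rw [Subsingleton.elim i 0]
  rw [this, h]

theorem form_two_sum_left (β : E4 [⋀^Fin 2]→L[ℝ] ℝ) (c : Fin 4 → ℝ) (u : Fin 4 → E4) (w : E4) :
    β ![∑ k, c k • u k, w] = ∑ k, c k * β ![u k, w] := by
  have h : ∀ v : E4, β ![v, w] = β.toMultilinearMap.toLinearMap ![0, w] 0 v := by
    intro v
    rw [MultilinearMap.toLinearMap_apply]
    change β _ = β _
    congr 1
    funext i
    fin_cases i <;> rfl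
  simp only [h, map_sum, map_smul, smul_eq_mul]

theorem form_two_sum_right (β : E4 [⋀^Fin 2]→L[ℝ] ℝ) (c : Fin 4 → ℝ) (u : Fin 4 → E4) (w : E4) :
    β ![w, ∑ k, c k • u k] = ∑ k, c k * β ![w, u k] := by
  have h : ∀ v : E4, β ![w, v] = β.toMultilinearMap.toLinearMap ![w, 0] 1 v := by
    intro v
    rw [MultilinearMap.toLinearMap_apply]
    change β _ = β _
    congr 1
    funext i
    fin_cases i <;> rfl
  simp only [h, map_sum, map_smul, smul_eq_mul]

theorem matEnd_e (B : Matrix (Fin 4) (Fin 4) ℝ) (a : Fin 4) : matEnd B (e a) = ∑ k, B k a • e k := by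
  ext i
  simp [matEnd, e, Pi.single_apply]

namespace Spacetime

variable (S : Spacetime M)

/-- The matrix `∇_c αₐ`. -/
def grad (x₀ : M) (a : Fin 4 → E4 → ℝ) (y : E4) : Matrix (Fin 4) (Fin 4) ℝ :=
  Matrix.of fun c j => pd c (a j) y - ∑ k, S.conn x₀ c y k j * a k y

/-- The covariant derivative in the direction `∂_b` of a covariant tensor of rank two. -/
def gradM (x₀ : M) (b : Fin 4) (X : E4 → Matrix (Fin 4) (Fin 4) ℝ) (y : E4) :
    Matrix (Fin 4) (Fin 4) ℝ :=
  pdM b X y - (S.conn x₀ b y).transpose * X y - X y * S.conn x₀ b y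

theorem covD_one_apply (x₀ : M) {α : E4 → E4 [⋀^Fin 1]→L[ℝ] ℝ} {y : E4}
    (hα : DifferentiableAt ℝ α y) (i j : Fin 4) :
    S.covD x₀ i α y (fun _ => e j) = S.grad x₀ (comp1 α) y i j := by
  rw [covD, ContinuousAlternatingMap.sub_apply, derivAction_apply, pd_form_apply i hα]
  simp only [Finset.univ_unique, Finset.sum_singleton, grad, Matrix.of_apply]
  congr 1
  have : (Function.update (fun _ : Fin 1 => e j) default
      (matEnd (Matrix.of fun k j => S.christoffel x₀ k i j y) (e j))) =
      fun _ => ∑ k, S.conn x₀ i y k j • e k := by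
    funext l
    rw [Subsingleton.elim l default, Function.update_self, matEnd_e]
    rfl
  rw [this, form_one_sum]
  rfl

theorem covD_two_apply (x₀ : M) {β : E4 → E4 [⋀^Fin 2]→L[ℝ] ℝ} {y : E4}
    (hβ : DifferentiableAt ℝ β y) (b i j : Fin 4) :
    S.covD x₀ b β y ![e i, e j] = S.gradM x₀ b (comp2 β) y i j := by
  rw [covD, ContinuousAlternatingMap.sub_apply, derivAction_apply, pd_form_apply b hβ]
  have h0 : Function.update ![e i, e j] 0 (matEnd (Matrix.of fun k j => S.christoffel x₀ k b j y)
      (![e i, e j] 0)) = ![∑ k, S.conn x₀ b y k i • e k, e j] := by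
    funext l
    fin_cases l
    · exact matEnd_e _ _
    · rfl
  have h1 : Function.update ![e i, e j] 1 (matEnd (Matrix.of fun k j => S.christoffel x₀ k b j y)
      (![e i, e j] 1)) = ![e i, ∑ k, S.conn x₀ b y k j • e k] := by
    funext l
    fin_cases l
    · rfl
    · exact matEnd_e _ _
  rw [Fin.sum_univ_two, h0, h1, form_two_sum_left, form_two_sum_right]
  simp only [gradM, Matrix.sub_apply, Matrix.mul_apply, Matrix.transpose_apply, comp2,
    Matrix.of_apply, pdM, mul_comm (β y _)]
  ring

/-- The derivative of g⁻¹ supplies, up to cyclicity of the trace, exactly the two connection terms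
of `gradM`: contraction with g⁻¹ commutes with ∇. -/
theorem trace_inv_mul_gradM [IsManifold (𝓡 4) ∞ M] {y : E4} (x₀ : M)
    (hy : y ∈ (extChartAt (𝓡 4) x₀).target) {X : E4 → Matrix (Fin 4) (Fin 4) ℝ}
    (hX : SmoothMatAt X y) (a : Fin 4) :
    pd a (fun z => (S.inv x₀ z * X z).trace) y = (S.inv x₀ y * S.gradM x₀ a X y).trace := by
  have hi := S.smoothMatAt_inv x₀ hy
  have h1 : pd a (fun z => (S.inv x₀ z * X z).trace) y =
      (pdM a (fun z => S.inv x₀ z * X z) y).trace :=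
    pd_sum a fun c _ => (hi.mul hX).diff c c
  rw [h1, pdM_mul hi hX, S.pdM_inv x₀ hy, gradM]
  simp only [Matrix.mul_sub, Matrix.add_mul, Matrix.neg_mul, Matrix.trace_add, Matrix.trace_sub,
    Matrix.trace_neg]
  rw [Matrix.mul_assoc (S.conn x₀ a y), Matrix.trace_mul_comm (S.conn x₀ a y), ← Matrix.mul_assoc,
    ← Matrix.mul_assoc]
  ring

theorem smoothMatAt_grad [IsManifold (𝓡 4) ∞ M] {y : E4} (x₀ : M)
    (hy : y ∈ (extChartAt (𝓡 4) x₀).target) {a : Fin 4 → E4 → ℝ}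
    (ha : ∀ j, ContDiffAt ℝ ∞ (a j) y) : SmoothMatAt (S.grad x₀ a) y := fun c j =>
  (contDiffAt_pd (ha j) c).sub (ContDiffAt.sum fun k _ =>
    (S.smoothMatAt_conn x₀ hy c k j).mul (ha k))

/-- The Ricci identity. -/
theorem gradM_grad_comm [IsManifold (𝓡 4) ∞ M] {y : E4} (x₀ : M)
    (hy : y ∈ (extChartAt (𝓡 4) x₀).target) {a : Fin 4 → E4 → ℝ}
    (ha : ∀ j, ContDiffAt ℝ ∞ (a j) y) (i j c : Fin 4) :
    S.gradM x₀ i (S.grad x₀ a) y j c - S.gradM x₀ j (S.grad x₀ a) y i c =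
      -∑ m, a m y * S.curv x₀ i j y m c := by
  have hd : ∀ j, DifferentiableAt ℝ (a j) y := fun j => (ha j).differentiableAt (by simp)
  have hpd : ∀ i j c, pd i (fun z => S.grad x₀ a z j c) y = pd i (pd j (a c)) y -
      ∑ k, (pdM i (S.conn x₀ j) y k c * a k y + S.conn x₀ j y k c * pd i (a k) y) := by
    intro i j c
    have hc := S.smoothMatAt_conn x₀ hy j
    simp only [grad, Matrix.of_apply]
    rw [pd_sub (f := pd j (a c)) (g := fun z => ∑ k, S.conn x₀ j z k c * a k z) i ((contDiffAt_pd (ha c) j).differentiableAt (by simp))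
      (DifferentiableAt.fun_sum fun k _ => (hc.diff k c).mul (hd k)),
      pd_sum (f := fun k z => S.conn x₀ j z k c * a k z) i fun k _ => (hc.diff k c).mul (hd k)]
    congr 1
    exact Finset.sum_congr rfl fun k _ => pd_mul i (hc.diff k c) (hd k)
  simp only [gradM, Matrix.sub_apply, Matrix.mul_apply, Matrix.transpose_apply]
  have h1 : ∀ i, pdM i (S.grad x₀ a) y = Matrix.of fun j c =>
      pd i (fun z => S.grad x₀ a z j c) y := fun i => rfl
  -- Second partials cancel by Schwarz; the correction of the outer derivative index cancels because
  -- Γ is symmetric. What survives is the curvature in the form of `curv_eq`.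
  simp only [h1, Matrix.of_apply, hpd, pd_pd_comm (ha c) i j, curv_eq, Matrix.add_apply,
    Matrix.sub_apply, Matrix.mul_apply, S.conn_symm x₀ j _ i y]
  simp only [grad, Matrix.of_apply, Fin.sum_univ_four]
  ring

end Spacetime
end Komar

/-! ### Exterior derivatives of Hodge duals as divergences -/

namespace Komar

theorem sum_fin_two {X : Type*} [AddCommMonoid X] (f : (Fin 2 → Fin 4) → X) :
    ∑ a, f a = ∑ i, ∑ j, f ![i, j] := by
  rw [← Fintype.sum_prod_type']
  exact (Fintype.sum_equiv (finTwoArrowEquiv (Fin 4)).symm _ _ fun a => by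
    congr 1).symm

theorem hodge_one_three_eq (h : 1 + 3 = 4) (G : Matrix (Fin 4) (Fin 4) ℝ)
    (τ : E4 [⋀^Fin 4]→L[ℝ] ℝ) (α : E4 [⋀^Fin 1]→L[ℝ] ℝ) :
    hodge h G τ α = ∑ c, (∑ b, α (fun _ => e b) * G b c) • insertFirst h (fun _ => e c) τ := by
  rw [hodge]
  simp only [sum_fin_one, Finset.sum_smul, Finset.univ_unique, Finset.prod_singleton,
    Nat.factorial_one, Nat.cast_one, inv_one, one_smul]
  exact Finset.sum_comm

theorem hodge_two_two_eq (h : 2 + 2 = 4) (G : Matrix (Fin 4) (Fin 4) ℝ)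
    (τ : E4 [⋀^Fin 4]→L[ℝ] ℝ) (α : E4 [⋀^Fin 2]→L[ℝ] ℝ) :
    hodge h G τ α = ∑ c, ∑ d, ((1 / 2) * (G.transpose * (Matrix.of fun i j => α ![e i, e j]) * G) c d) •
      insertFirst h ![e c, e d] τ := by
  have he : ∀ i j, (fun k => e (![i, j] k)) = ![e i, e j] := by
    intro i j; funext k; fin_cases k <;> rfl
  rw [hodge]
  simp only [sum_fin_two, he, Fin.prod_univ_two, Matrix.cons_val_zero, Matrix.cons_val_one]
  simp only [Matrix.mul_apply, Matrix.transpose_apply, Matrix.of_apply, Finset.smul_sum, smul_smul,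
    Finset.sum_mul, Finset.mul_sum, Finset.sum_smul]
  have h2 : ((Nat.factorial 2 : ℕ) : ℝ)⁻¹ = 1 / 2 := by norm_num [Nat.factorial]
  rw [h2]
  calc _ = ∑ i, ∑ c, ∑ d, ∑ j, (1 / 2 * (α ![e i, e j] * (G i c * G j d))) •
        insertFirst h ![e c, e d] τ := by
        refine Finset.sum_congr rfl fun i _ => ?_
        rw [Finset.sum_comm]
        exact Finset.sum_congr rfl fun c _ => Finset.sum_comm
    _ = ∑ c, ∑ d, ∑ i, ∑ j, (1 / 2 * (α ![e i, e j] * (G i c * G j d))) •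
        insertFirst h ![e c, e d] τ := by
        rw [Finset.sum_comm]
        exact Finset.sum_congr rfl fun c _ => Finset.sum_comm
    _ = _ := by
        refine Finset.sum_congr rfl fun c _ => Finset.sum_congr rfl fun d _ => ?_
        rw [Finset.sum_comm]
        refine Finset.sum_congr rfl fun i _ => Finset.sum_congr rfl fun j _ => ?_
        congr 1
        ring

theorem insertFirst_smul {p q : ℕ} (h : p + q = 4) (u : Fin p → E4) (τ : E4 [⋀^Fin 4]→L[ℝ] ℝ)
    (r : ℝ) : insertFirst h u (r • τ) = r • insertFirst h u τ := rfl

/-- The `1`-form with given components. -/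
def form1 (c : Fin 4 → ℝ) : E4 [⋀^Fin 1]→L[ℝ] ℝ :=
  ContinuousAlternatingMap.ofSubsingleton ℝ E4 ℝ (0 : Fin 1)
    (∑ j, c j • (EuclideanSpace.proj j : E4 →L[ℝ] ℝ))

@[simp] theorem form1_apply_e (c : Fin 4 → ℝ) (j : Fin 4) : form1 c (fun _ => e j) = c j := by
  simp [form1, sum_apply]

theorem differentiableAt_form_apply {p : ℕ} {α : E4 → E4 [⋀^Fin p]→L[ℝ] ℝ} {y : E4}
    (h : DifferentiableAt ℝ α y) (v : Fin p → E4) : DifferentiableAt ℝ (fun z => α z v) y :=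
  (ContinuousAlternatingMap.apply ℝ E4 ℝ v).differentiableAt.comp y h

theorem contDiffAt_form_apply {p : ℕ} {α : E4 → E4 [⋀^Fin p]→L[ℝ] ℝ} {y : E4}
    (h : ContDiffAt ℝ ∞ α y) (v : Fin p → E4) : ContDiffAt ℝ ∞ (fun z => α z v) y :=
  (ContinuousAlternatingMap.apply ℝ E4 ℝ v).contDiff.contDiffAt.comp y h

theorem smoothMatAt_comp2 {β : E4 → E4 [⋀^Fin 2]→L[ℝ] ℝ} {y : E4} (h : ContDiffAt ℝ ∞ β y) :
    SmoothMatAt (comp2 β) y := fun _ _ => contDiffAt_form_apply h _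

theorem comp2_skew (β : E4 → E4 [⋀^Fin 2]→L[ℝ] ℝ) (z : E4) :
    (comp2 β z).transpose = -comp2 β z := by
  ext i j
  have h : β z (![e i, e j] ∘ Equiv.swap 0 1) = -β z ![e i, e j] :=
    (β z).toAlternatingMap.map_swap _ (by simp)
  have h2 : (![e i, e j] ∘ Equiv.swap 0 1) = ![e j, e i] := by
    funext k; fin_cases k <;> rfl
  rw [h2] at h
  exact h

variable {M : Type*} [TopologicalSpace M] [ChartedSpace E4 M]

namespace Spacetime

variable (S : Spacetime M)

/-- The divergence `gᵇᶜ ∇_b α_c`. -/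
def divOne (x₀ : M) (α : E4 → E4 [⋀^Fin 1]→L[ℝ] ℝ) (y : E4) : ℝ :=
  (S.inv x₀ y * S.grad x₀ (comp1 α) y).trace

/-- The divergence `gᵇᶜ ∇_b F_{ca}`. -/
def divTwo (x₀ : M) (β : E4 → E4 [⋀^Fin 2]→L[ℝ] ℝ) (a : Fin 4) (y : E4) : ℝ :=
  ∑ b, ∑ c, S.inv x₀ y b c * S.gradM x₀ b (comp2 β) y c a

/-- The ratio of the volume form to its value at `y`. -/
def density (x₀ : M) (y z : E4) : ℝ := chartForm S.τ x₀ z e * (chartForm S.τ x₀ y e)⁻¹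

theorem differentiableAt_density {y : E4} (x₀ : M) (hy : y ∈ (extChartAt (𝓡 4) x₀).target) :
    DifferentiableAt ℝ (S.density x₀ y) y :=
  ((S.smooth_volume x₀ hy).differentiableAt (by simp)).mul_const _

theorem gradM_skew (x₀ : M) (β : E4 → E4 [⋀^Fin 2]→L[ℝ] ℝ) (b : Fin 4) (y : E4) :
    (S.gradM x₀ b (comp2 β) y).transpose = -S.gradM x₀ b (comp2 β) y := by
  have h : (pdM b (comp2 β) y).transpose = -pdM b (comp2 β) y := by
    rw [← pdM_transpose, ← pdM_neg]
    congr 1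
    funext z
    exact comp2_skew β z
  simp only [gradM, Matrix.transpose_sub, Matrix.transpose_mul, Matrix.transpose_transpose, h,
    comp2_skew]
  noncomm_ring

variable [IsManifold (𝓡 4) ∞ M]

/-- Freezing the volume form at y leaves a scalar density as the only variable factor, so the
formulas for a constant τ apply. -/
theorem volume_eq_smul {y : E4} (x₀ : M) (hy : y ∈ (extChartAt (𝓡 4) x₀).target) (z : E4) :
    chartForm S.τ x₀ z =
      (chartForm S.τ x₀ z e * (chartForm S.τ x₀ y e)⁻¹) • chartForm S.τ x₀ y := by
  ext v
  rw [ContinuousAlternatingMap.smul_apply, form_four_apply _ v,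
    form_four_apply (chartForm S.τ x₀ y) v, smul_eq_mul]
  field_simp [S.volume_ne_zero x₀ hy]

/-- At y the density equals 1 and its derivative is tr Γᵢ, the volume form being parallel. -/
theorem pd_density_mul {y : E4} (x₀ : M) (hy : y ∈ (extChartAt (𝓡 4) x₀).target) {f : E4 → ℝ}
    (hf : DifferentiableAt ℝ f y) (i : Fin 4) :
    pd i (fun z => S.density x₀ y z * f z) y = (S.conn x₀ i y).trace * f y + pd i f y := by
  have hs := (S.smooth_volume x₀ hy).differentiableAt (by simp)
  have h0 := S.volume_ne_zero x₀ hy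
  rw [pd_mul i (S.differentiableAt_density x₀ hy) hf]
  have : pd i (S.density x₀ y) y = (S.conn x₀ i y).trace := by
    rw [show S.density x₀ y = fun z => (chartForm S.τ x₀ y e)⁻¹ * chartForm S.τ x₀ z e from
      funext fun z => mul_comm _ _, pd_const_mul i _ hs, S.pd_volume x₀ hy,
      inv_mul_cancel_left₀ h0]
  rw [this, density, mul_inv_cancel₀ h0, one_mul]

theorem extDeriv_hodge_one {y : E4} (x₀ : M) (hy : y ∈ (extChartAt (𝓡 4) x₀).target)
    (h : 1 + 3 = 4) {α : E4 → E4 [⋀^Fin 1]→L[ℝ] ℝ} (hα : DifferentiableAt ℝ α y) :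
    extDeriv (fun z => hodge h (S.inv x₀ z) (chartForm S.τ x₀ z) (α z)) y =
      S.divOne x₀ α y • chartForm S.τ x₀ y := by
  have hi := S.smoothMatAt_inv x₀ hy
  have ha : ∀ b, DifferentiableAt ℝ (comp1 α b) y := fun b => differentiableAt_form_apply hα _
  set f : Fin 4 → E4 → ℝ := fun c z => ∑ b, comp1 α b z * S.inv x₀ z b c with hfdef
  have h1 : (fun z => hodge h (S.inv x₀ z) (chartForm S.τ x₀ z) (α z)) = fun z =>
      ∑ c, (S.density x₀ y z * f c z) • insertFirst h (fun _ => e c) (chartForm S.τ x₀ y) := by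
    funext z
    rw [hodge_one_three_eq]
    refine Finset.sum_congr rfl fun c _ => ?_
    conv_lhs => rw [S.volume_eq_smul x₀ hy z]
    rw [insertFirst_smul, smul_smul, mul_comm]
    rfl
  have hf : ∀ c, DifferentiableAt ℝ (f c) y := fun c =>
    DifferentiableAt.fun_sum fun b _ => (ha b).mul (hi.diff b c)
  rw [h1, extDeriv_contract_one (P := fun c z => S.density x₀ y z * f c z) _ h
    fun c => (S.differentiableAt_density x₀ hy).mul (hf c)]
  congr 1
  have h2 : ∀ c, pd c (f c) y =
      ∑ b, (pd c (comp1 α b) y * S.inv x₀ y b c + comp1 α b y * pdM c (S.inv x₀) y b c) := by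
    intro c
    rw [hfdef, pd_sum (f := fun b z => comp1 α b z * S.inv x₀ z b c) c
      fun b _ => (ha b).mul (hi.diff b c)]
    exact Finset.sum_congr rfl fun b _ => pd_mul c (ha b) (hi.diff b c)
  simp only [S.pd_density_mul x₀ hy (hf _), h2, S.pdM_inv x₀ hy, divOne, grad, Matrix.trace,
    Matrix.diag_apply, Matrix.mul_apply, Matrix.of_apply, Matrix.neg_apply, Matrix.add_apply,
    Matrix.transpose_apply]
  simp only [hfdef, Fin.sum_univ_four]
  -- Choosing one representative for each symmetric index pair lets `ring` cancel tr Γ against one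
  -- of the two connection terms from the derivative of g⁻¹.
  have hc := fun i k j => S.conn_symm x₀ i k j y
  have hg := S.inv_symm x₀ y
  rw [hg 1 0, hg 2 0, hg 3 0, hg 2 1, hg 3 1, hg 3 2]
  simp only [hc 1 _ 0, hc 2 _ 0, hc 3 _ 0, hc 2 _ 1, hc 3 _ 1, hc 3 _ 2]
  ring

/-- The derivative of the components of a bivector obtained by raising indices. -/
theorem pdM_raise_two {y : E4} (x₀ : M) (hy : y ∈ (extChartAt (𝓡 4) x₀).target)
    {B : E4 → Matrix (Fin 4) (Fin 4) ℝ} (hB : SmoothMatAt B y) (d : Fin 4) :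
    pdM d (fun z => S.inv x₀ z * B z * S.inv x₀ z) y =
      S.inv x₀ y * S.gradM x₀ d B y * S.inv x₀ y
        - S.conn x₀ d y * (S.inv x₀ y * B y * S.inv x₀ y)
        - (S.inv x₀ y * B y * S.inv x₀ y) * (S.conn x₀ d y).transpose := by
  have hi := S.smoothMatAt_inv x₀ hy
  rw [pdM_mul (hi.mul hB) hi, pdM_mul hi hB, S.pdM_inv x₀ hy, gradM]
  noncomm_ring

/-- The divergence of a bivector density. -/
theorem sum_pd_density_two {y : E4} (x₀ : M) (hy : y ∈ (extChartAt (𝓡 4) x₀).target)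
    {B : E4 → Matrix (Fin 4) (Fin 4) ℝ} (hB : SmoothMatAt B y) (hskew : ∀ z, (B z).transpose = -B z)
    (c : Fin 4) :
    ∑ d, pd d (fun z => S.density x₀ y z * (S.inv x₀ z * B z * S.inv x₀ z) c d) y =
      ∑ d, (S.inv x₀ y * S.gradM x₀ d B y * S.inv x₀ y) c d := by
  have hi := S.smoothMatAt_inv x₀ hy
  have hQ := (hi.mul hB).mul hi
  have h1 : ∀ d, pd d (fun z => S.density x₀ y z * (S.inv x₀ z * B z * S.inv x₀ z) c d) y =
      (S.conn x₀ d y).trace * (S.inv x₀ y * B y * S.inv x₀ y) c d +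
        pdM d (fun z => S.inv x₀ z * B z * S.inv x₀ z) y c d := fun d =>
    S.pd_density_mul x₀ hy (hQ.diff c d) d
  have hs : (S.inv x₀ y * B y * S.inv x₀ y).transpose = -(S.inv x₀ y * B y * S.inv x₀ y) := by
    rw [Matrix.transpose_mul, Matrix.transpose_mul, hskew, inv_transpose]
    noncomm_ring
  simp only [h1, S.pdM_raise_two x₀ hy hB]
  set Q := S.inv x₀ y * B y * S.inv x₀ y
  have hQs : ∀ i j, Q i j = -Q j i := fun i j => congrFun (congrFun hs j) i
  have hQd : ∀ i, Q i i = 0 := fun i => by linarith [hQs i i]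
  have hc := fun i k j => S.conn_symm x₀ i k j y
  simp only [Matrix.sub_apply, Finset.sum_add_distrib, Finset.sum_sub_distrib]
  -- Γ is symmetric in the two indices contracted with the skew Q.
  have hzero : ∑ d, (S.conn x₀ d y * Q) c d = 0 := by
    simp only [Matrix.mul_apply, Fin.sum_univ_four, hQd]
    simp only [hc 1 _ 0, hc 2 _ 0, hc 3 _ 0, hc 2 _ 1, hc 3 _ 1, hc 3 _ 2]
    rw [hQs 1 0, hQs 2 0, hQs 3 0, hQs 2 1, hQs 3 1, hQs 3 2]
    ring
  -- The density term cancels the remaining connection term, again by symmetry of Γ.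
  have hone : ∑ d, (S.conn x₀ d y).trace * Q c d = ∑ d, (Q * (S.conn x₀ d y).transpose) c d := by
    simp only [Matrix.trace, Matrix.diag_apply, Matrix.mul_apply, Matrix.transpose_apply,
      Finset.sum_mul]
    rw [Finset.sum_comm]
    refine Finset.sum_congr rfl fun d _ => Finset.sum_congr rfl fun l _ => ?_
    rw [S.conn_symm x₀ l, mul_comm]
  rw [hone, hzero]
  ring

theorem extDeriv_hodge_two {y : E4} (x₀ : M) (hy : y ∈ (extChartAt (𝓡 4) x₀).target)
    (h : 2 + 2 = 4) (h' : 1 + 3 = 4) {β : E4 → E4 [⋀^Fin 2]→L[ℝ] ℝ} (hβ : ContDiffAt ℝ ∞ β y) :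
    extDeriv (fun z => hodge h (S.inv x₀ z) (chartForm S.τ x₀ z) (β z)) y =
      hodge h' (S.inv x₀ y) (chartForm S.τ x₀ y) (form1 fun a => -S.divTwo x₀ β a y) := by
  have hi := S.smoothMatAt_inv x₀ hy
  have hB := smoothMatAt_comp2 hβ
  set Q : E4 → Matrix (Fin 4) (Fin 4) ℝ := fun z => S.inv x₀ z * comp2 β z * S.inv x₀ z with hQdef
  have hQ : SmoothMatAt Q y := (hi.mul hB).mul hi
  have hρ := S.differentiableAt_density x₀ hy
  have h1 : (fun z => hodge h (S.inv x₀ z) (chartForm S.τ x₀ z) (β z)) = fun z =>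
      ∑ c, ∑ d, ((1 / 2) * (S.density x₀ y z * Q z c d)) •
        insertFirst h ![e c, e d] (chartForm S.τ x₀ y) := by
    funext z
    rw [hodge_two_two_eq, inv_transpose]
    refine Finset.sum_congr rfl fun c _ => Finset.sum_congr rfl fun d _ => ?_
    conv_lhs => rw [S.volume_eq_smul x₀ hy z]
    rw [insertFirst_smul, smul_smul, mul_assoc]
    congr 2
    exact mul_comm _ _
  have hd : ∀ c d, DifferentiableAt ℝ (fun z => S.density x₀ y z * Q z c d) y := fun c d =>
    hρ.mul (hQ.diff c d)
  rw [h1, extDeriv_contract_two (P := fun c d z => (1 / 2) * (S.density x₀ y z * Q z c d)) _ h h'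
    fun c d => (hd c d).const_mul _]
  have hsum := S.sum_pd_density_two x₀ hy hB (comp2_skew β)
  have hQs : ∀ z c d, Q z c d = -Q z d c := by
    intro z c d
    have : (Q z).transpose = -Q z := by
      rw [hQdef, Matrix.transpose_mul, Matrix.transpose_mul, comp2_skew, inv_transpose]
      noncomm_ring
    exact congrFun (congrFun this d) c
  obtain ⟨U, hU⟩ : ∃ U : Fin 4 → Fin 4 → ℝ, ∀ c d, U c d =
      pd d (fun z => (1 / 2) * (S.density x₀ y z * Q z c d)) y := ⟨_, fun _ _ => rfl⟩
  -- Skewness of Q makes the two terms of `extDeriv_contract_two` equal after relabelling, which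
  -- cancels the factor 1/2 of the star.
  have hP : ∀ c d, pd c (fun z => (1 / 2) * (S.density x₀ y z * Q z c d)) y = -U d c := by
    intro c d
    rw [hU, pd_const_mul c _ (hd c d), pd_const_mul c _ (hd d c), ← mul_neg, ← neg_one_mul,
      ← pd_const_mul c _ (hd d c)]
    congr 2
    funext z
    rw [hQs z c d]
    ring
  simp only [← hU, hP]
  rw [hodge_one_three_eq]
  ext w
  simp only [ContinuousAlternatingMap.sum_apply, ContinuousAlternatingMap.sub_apply,
    ContinuousAlternatingMap.smul_apply, smul_eq_mul, neg_mul, sub_neg_eq_add,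
    Finset.sum_add_distrib]
  rw [Finset.sum_comm (f := fun c d => U d c * _), ← Finset.sum_add_distrib]
  refine Finset.sum_congr rfl fun c _ => ?_
  rw [← Finset.sum_add_distrib]
  simp only [← add_mul, ← Finset.sum_mul]
  congr 1
  have h3 : ∑ d, (U c d + U c d) = ∑ d, pd d (fun z => S.density x₀ y z * Q z c d) y :=
    Finset.sum_congr rfl fun d _ => by rw [hU, pd_const_mul d _ (hd c d)]; ring
  rw [h3, hsum]
  -- The derivative index is contracted with the second index here but with the first in `divTwo`;
  -- exchanging them produces the minus sign.
  have hN : ∀ b i j, S.gradM x₀ b (comp2 β) y i j = -S.gradM x₀ b (comp2 β) y j i := fun b i j =>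
    congrFun (congrFun (S.gradM_skew x₀ β b y) j) i
  have h4 : ∀ d, (S.inv x₀ y * S.gradM x₀ d (comp2 β) y * S.inv x₀ y) c d =
      ∑ a, ∑ k, S.inv x₀ y a c * (S.inv x₀ y d k * S.gradM x₀ d (comp2 β) y a k) := by
    intro d
    simp only [Matrix.mul_apply, Finset.sum_mul]
    rw [Finset.sum_comm]
    refine Finset.sum_congr rfl fun a _ => Finset.sum_congr rfl fun k _ => ?_
    rw [S.inv_symm x₀ y c a, S.inv_symm x₀ y k d]
    ring
  simp only [h4, form1_apply_e, divTwo]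
  rw [Finset.sum_comm]
  refine Finset.sum_congr rfl fun a _ => ?_
  simp only [← Finset.mul_sum]
  rw [mul_comm, ← Finset.sum_neg_distrib]
  congr 1
  refine Finset.sum_congr rfl fun b _ => ?_
  rw [← Finset.sum_neg_distrib]
  refine Finset.sum_congr rfl fun k _ => ?_
  rw [hN b a k]
  ring

end Spacetime
end Komar

/-! ### Codifferentials on the manifold -/

namespace Komar

variable {M : Type*} [TopologicalSpace M] [ChartedSpace E4 M]

theorem chartForm_smul {p : ℕ} (c : ℝ) (α : Form M p) (x₀ : M) :
    chartForm (fun x => c • α x) x₀ = c • chartForm α x₀ := rfl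

theorem extd_smul {p : ℕ} (c : ℝ) (α : Form M p) :
    extd (fun x => c • α x) = fun x => c • extd α x := by
  funext x
  rw [extd, chartForm_smul]
  exact extDeriv_smul c _

theorem hodge_smul {p q : ℕ} (h : p + q = 4) (G : Matrix (Fin 4) (Fin 4) ℝ)
    (τ : E4 [⋀^Fin 4]→L[ℝ] ℝ) (c : ℝ) (α : E4 [⋀^Fin p]→L[ℝ] ℝ) :
    hodge h G τ (c • α) = c • hodge h G τ α := by
  ext w
  simp only [ContinuousAlternatingMap.smul_apply, hodge_apply, smul_eq_mul, Finset.mul_sum]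
  exact Finset.sum_congr rfl fun a _ => by ring

theorem SmoothForm.contDiffAt {p : ℕ} {α : Form M p} (hα : SmoothForm α) {y : E4} (x₀ : M)
    (hy : y ∈ (extChartAt (𝓡 4) x₀).target) : ContDiffAt ℝ ∞ (chartForm α x₀) y :=
  (hα x₀).contDiffAt ((isOpen_chart_target x₀).mem_nhds hy)

namespace Spacetime

variable (S : Spacetime M)

theorem star_smul {p q : ℕ} (h : p + q = 4) (c : ℝ) (α : Form M p) :
    S.star h (fun x => c • α x) = fun x => c • S.star h α x :=
  funext fun _ => hodge_smul h _ _ c _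

theorem gradM_transpose (x₀ : M) (b : Fin 4) (X : E4 → Matrix (Fin 4) (Fin 4) ℝ) (y : E4) :
    S.gradM x₀ b (fun z => (X z).transpose) y = (S.gradM x₀ b X y).transpose := by
  simp only [gradM, pdM_transpose, Matrix.transpose_sub, Matrix.transpose_mul,
    Matrix.transpose_transpose]
  abel

theorem gradM_sub (x₀ : M) (b : Fin 4) {X Y : E4 → Matrix (Fin 4) (Fin 4) ℝ} {y : E4}
    (hX : SmoothMatAt X y) (hY : SmoothMatAt Y y) :
    S.gradM x₀ b (fun z => X z - Y z) y = S.gradM x₀ b X y - S.gradM x₀ b Y y := by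
  have : pdM b (fun z => X z - Y z) y = pdM b X y - pdM b Y y := by
    ext i j
    exact pd_sub b (hX.diff i j) (hY.diff i j)
  rw [gradM, this, gradM, gradM]
  noncomm_ring

theorem gradM_congr (x₀ : M) (b : Fin 4) {X Y : E4 → Matrix (Fin 4) (Fin 4) ℝ} {y : E4}
    (h : X =ᶠ[nhds y] Y) : S.gradM x₀ b X y = S.gradM x₀ b Y y := by
  rw [gradM, gradM, pdM_congr h, h.self_of_nhds]

/-- The components of the exterior derivative of a `1`-form. -/
theorem comp2_extDeriv (x₀ : M) {α : E4 → E4 [⋀^Fin 1]→L[ℝ] ℝ} {y : E4}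
    (hα : DifferentiableAt ℝ α y) : comp2 (extDeriv α) y =
      S.grad x₀ (comp1 α) y - (S.grad x₀ (comp1 α) y).transpose := by
  ext i j
  have hr : ∀ k : Fin 2, k.removeNth ![e i, e j] = ![fun _ => e j, fun _ => e i] k := by
    intro k
    funext l
    fin_cases k <;> fin_cases l <;> rfl
  have h : extDeriv α y ![e i, e j] = pd i (comp1 α j) y - pd j (comp1 α i) y := by
    rw [extDeriv_apply hα, Fin.sum_univ_two, hr, hr]
    simp only [Fin.val_zero, pow_zero, one_smul, Fin.val_one, pow_one, neg_smul, pd]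
    rfl
  simp only [comp2, Matrix.of_apply, Matrix.sub_apply, Matrix.transpose_apply, grad, h,
    S.conn_symm x₀ i _ j]
  ring

variable [IsManifold (𝓡 4) ∞ M]

/-- Two signs cancel: −1 from δ in degree one, and ⋆⁻¹ = −⋆ on four-forms. -/
theorem codiff_three_eq (α : Form M 1) :
    S.codiff 3 rfl α = S.star (by omega : 4 + 0 = 4) (extd (S.star (by omega : 1 + 3 = 4) α)) := by
  funext x
  rw [codiff, starInv_eq, smul_smul]
  norm_num

/-- Both signs are +1: δ has none in degree two, and ⋆⁻¹ = ⋆ on three-forms. -/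
theorem codiff_two_eq (β : Form M 2) :
    S.codiff 2 rfl β = S.star (by omega : 3 + 1 = 4) (extd (S.star (by omega : 2 + 2 = 4) β)) := by
  funext x
  rw [codiff, starInv_eq, smul_smul]
  norm_num

theorem chartForm_star_eventuallyEq {p q : ℕ} (h : p + q = 4) (α : Form M p) {y : E4} (x₀ : M)
    (hy : y ∈ (extChartAt (𝓡 4) x₀).target) : chartForm (S.star h α) x₀ =ᶠ[nhds y]
      fun z => hodge h (S.inv x₀ z) (chartForm S.τ x₀ z) (chartForm α x₀ z) := by
  filter_upwards [(isOpen_chart_target x₀).mem_nhds hy] with z hz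
  exact S.chartForm_star x₀ hz h α

/-- The codifferential of a `1`-form in coordinates. -/
theorem chartForm_codiff_one {α : Form M 1} (hα : SmoothForm α) {y : E4} (x₀ : M)
    (hy : y ∈ (extChartAt (𝓡 4) x₀).target) :
    chartForm (S.codiff 3 rfl α) x₀ y =
      ContinuousAlternatingMap.constOfIsEmpty ℝ E4 (Fin 0) (-S.divOne x₀ (chartForm α x₀) y) := by
  set c := ContinuousAlternatingMap.constOfIsEmpty ℝ E4 (Fin 0) (S.divOne x₀ (chartForm α x₀) y)
    with hc
  -- Reading (div α)τ as the star of the function div α lets ⋆⋆ = −1 finish.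
  have h1 : chartForm (extd (S.star (by omega : 1 + 3 = 4) α)) x₀ y =
      hodge (by omega : 0 + 4 = 4) (S.inv x₀ y) (chartForm S.τ x₀ y) c := by
    rw [chartForm_extd (S.smoothForm_star _ hα).differentiableOn x₀ hy,
      (S.chartForm_star_eventuallyEq _ α x₀ hy).extDeriv_eq,
      S.extDeriv_hodge_one x₀ hy _ ((hα.contDiffAt x₀ hy).differentiableAt (by simp)),
      hodge_zero_four]
    rfl
  rw [codiff_three_eq, S.chartForm_star x₀ hy, h1]
  refine (hodge_hodge_zero _ _ _ _ (S.volume_sq_mul x₀ hy) c).trans ?_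
  ext v
  rfl

theorem extd_codiff_apply {α : Form M 1} (hα : SmoothForm α) (x : M) (a : Fin 4) :
    extd (S.codiff 3 rfl α) x (fun _ => e a) = -pd a (S.divOne x (chartForm α x)) (base x) := by
  have h : chartForm (S.codiff 3 rfl α) x =ᶠ[nhds (base x)] fun z =>
      ContinuousAlternatingMap.constOfIsEmpty ℝ E4 (Fin 0) (-S.divOne x (chartForm α x) z) := by
    filter_upwards [(isOpen_chart_target x).mem_nhds (base_mem_target x)] with z hz
    exact S.chartForm_codiff_one hα x hz
  rw [extd, h.extDeriv_eq, extDeriv_constOfIsEmpty]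
  change fderiv ℝ (fun z => -S.divOne x (chartForm α x) z) (base x) (e a) = _
  rw [fderiv_fun_neg]
  rfl

theorem extd_star_two_apply {β : Form M 2} (hβ : SmoothForm β) (x : M) :
    extd (S.star (by omega : 2 + 2 = 4) β) x = S.star (by omega : 1 + 3 = 4)
      (fun x => form1 fun a => -S.divTwo x (chartForm β x) a (base x)) x := by
  have hx := base_mem_target x
  rw [extd, (S.chartForm_star_eventuallyEq _ β x hx).extDeriv_eq,
    S.extDeriv_hodge_two x hx _ (by omega) (hβ.contDiffAt x hx), chartForm_base]
  rfl

/-- The codifferential of a `2`-form. -/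
theorem codiff_two_apply {β : Form M 2} (hβ : SmoothForm β) (x : M) :
    S.codiff 2 rfl β x = form1 fun a => -S.divTwo x (chartForm β x) a (base x) := by
  rw [codiff_two_eq, funext (S.extd_star_two_apply hβ), star_star_one]

/-- `d ⋆ β = ⋆ δ β` for `2`-forms. -/
theorem extd_star_two {β : Form M 2} (hβ : SmoothForm β) :
    extd (S.star (by omega : 2 + 2 = 4) β) =
      S.star (by omega : 1 + 3 = 4) (S.codiff 2 rfl β) := by
  rw [funext (S.codiff_two_apply hβ), funext (S.extd_star_two_apply hβ)]

/-- Because d⋆β = ⋆δβ, δδβ is ⋆ of dd⋆β. -/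
theorem codiff_codiff {β : Form M 2} (hβ : SmoothForm β) :
    S.codiff 3 rfl (S.codiff 2 rfl β) = 0 := by
  rw [codiff_three_eq, ← S.extd_star_two hβ, (S.smoothForm_star _ hβ).extd_extd]
  funext x
  have := hodge_smul (p := 4) (q := 0) (by omega) (S.ginv x) (S.τ x) 0 0
  rwa [zero_smul, zero_smul] at this

theorem codiff_neg_one (α : Form M 1) : S.codiff 3 rfl (-α) = -S.codiff 3 rfl α := by
  have h : (-α : Form M 1) = fun x => (-1 : ℝ) • α x := by
    funext x
    simp only [Pi.neg_apply]
    exact (neg_one_smul ℝ (α x)).symm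
  rw [h, codiff_three_eq, codiff_three_eq, star_smul, extd_smul, star_smul]
  funext x
  ext v
  rw [Pi.neg_apply, ContinuousAlternatingMap.smul_apply, ContinuousAlternatingMap.neg_apply,
    smul_eq_mul, neg_one_mul]

/-! ### The Weitzenböck formula for `1`-forms -/

/-- Skewness of the curvature turns the trace defining Ricci into the contraction with g⁻¹ that
arises when covariant derivatives are commuted. -/
theorem inv_mul_ricci_apply {y : E4} (x : M) (hx : y ∈ (extChartAt (𝓡 4) x).target) (m a : Fin 4) :
    (S.inv x y * Matrix.of fun r s => ∑ k, S.riemann x k r s k y) m a =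
      -∑ b, ∑ c, S.inv x y b c * S.curv x a b y m c := by
  have h5 : ∀ b, (S.curv x a b y * S.inv x y) m b = -(S.inv x y * (S.curv x a b y).transpose) m b :=
    fun b => congrFun (congrFun (S.curv_skew x hx a b) m) b
  have h6 : ∀ b, ∑ c, S.inv x y b c * S.curv x a b y m c = (S.curv x a b y * S.inv x y) m b := by
    intro b
    rw [Matrix.mul_apply]
    exact Finset.sum_congr rfl fun c _ => by rw [S.inv_symm x y b c, mul_comm]
  have h7 : ∀ n, (Matrix.of fun r s => ∑ k, S.riemann x k r s k y) n a =
      ∑ b, S.curv x a b y b n := fun n => rfl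
  simp only [h6, h5, Finset.sum_neg_distrib, neg_neg]
  simp only [Matrix.mul_apply, h7, Matrix.transpose_apply, Finset.mul_sum]
  exact Finset.sum_comm

theorem pd_divOne {α : Form M 1} (hα : SmoothForm α) {y : E4} (x : M)
    (hx : y ∈ (extChartAt (𝓡 4) x).target) (a : Fin 4) :
    pd a (S.divOne x (chartForm α x)) y =
      ∑ b, ∑ c, S.inv x y b c * S.gradM x a (S.grad x (comp1 (chartForm α x))) y b c := by
  have hX := S.smoothMatAt_grad x hx
    fun j => contDiffAt_form_apply (hα.contDiffAt x hx) (fun _ => e j)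
  refine (S.trace_inv_mul_gradM x hx hX a).trans ?_
  rw [Matrix.trace]
  simp only [Matrix.diag_apply, Matrix.mul_apply]
  rw [Finset.sum_comm]
  exact Finset.sum_congr rfl fun b _ => Finset.sum_congr rfl fun c _ => by
    rw [S.inv_symm x y c b]
    rfl

theorem gradM_comp2_extd {α : Form M 1} (hα : SmoothForm α) {y : E4} (x : M)
    (hx : y ∈ (extChartAt (𝓡 4) x).target) (b : Fin 4) :
    S.gradM x b (comp2 (chartForm (extd α) x)) y =
      S.gradM x b (S.grad x (comp1 (chartForm α x))) y -
        (S.gradM x b (S.grad x (comp1 (chartForm α x))) y).transpose := by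
  have hX := S.smoothMatAt_grad x hx
    fun j => contDiffAt_form_apply (hα.contDiffAt x hx) (fun _ => e j)
  have h1 : comp2 (chartForm (extd α) x) =ᶠ[nhds y] fun z =>
      S.grad x (comp1 (chartForm α x)) z - (S.grad x (comp1 (chartForm α x)) z).transpose := by
    filter_upwards [(isOpen_chart_target x).mem_nhds hx] with z hz
    have : comp2 (chartForm (extd α) x) z = comp2 (extDeriv (chartForm α x)) z := by
      simp only [comp2, chartForm_extd hα.differentiableOn x hz]
    rw [this]
    exact S.comp2_extDeriv x ((hα.contDiffAt x hz).differentiableAt (by simp))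
  rw [S.gradM_congr x b h1, ← gradM_transpose]
  exact S.gradM_sub x b hX hX.transpose

/-- In gᵇᶜ∇_b(∇_c α_a − ∇_a α_c) the second term is commuted by the Ricci identity: it becomes the
gradient of the divergence plus a curvature term, which contracts to Ricci. -/
theorem weitzenbock {α : Form M 1} (hα : SmoothForm α) {y : E4} (x : M)
    (hx : y ∈ (extChartAt (𝓡 4) x).target) (a : Fin 4) :
    S.divTwo x (chartForm (extd α) x) a y =
      ∑ b, ∑ c, S.inv x y b c * S.gradM x b (S.grad x (comp1 (chartForm α x))) y c a
        - pd a (S.divOne x (chartForm α x)) y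
        + ∑ m, comp1 (chartForm α x) m y *
          (S.inv x y * Matrix.of fun r s => ∑ k, S.riemann x k r s k y) m a := by
  have h3 := S.gradM_grad_comm (a := comp1 (chartForm α x)) x hx
    fun j => contDiffAt_form_apply (hα.contDiffAt x hx) (fun _ => e j)
  have h4 : ∑ m, comp1 (chartForm α x) m y *
      (S.inv x y * Matrix.of fun r s => ∑ k, S.riemann x k r s k y) m a =
      -∑ b, ∑ c, S.inv x y b c * ∑ m, comp1 (chartForm α x) m y * S.curv x a b y m c := by
    simp only [S.inv_mul_ricci_apply x hx, mul_neg, Finset.sum_neg_distrib, Finset.mul_sum]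
    congr 1
    refine Finset.sum_comm.trans ?_
    refine Finset.sum_congr rfl fun b _ => Finset.sum_comm.trans ?_
    exact Finset.sum_congr rfl fun c _ => Finset.sum_congr rfl fun m _ => by ring
  rw [h4, S.pd_divOne hα x hx a, ← sub_eq_add_neg, divTwo, ← Finset.sum_sub_distrib,
    ← Finset.sum_sub_distrib]
  refine Finset.sum_congr rfl fun b _ => ?_
  rw [← Finset.sum_sub_distrib, ← Finset.sum_sub_distrib]
  refine Finset.sum_congr rfl fun c _ => ?_
  rw [S.gradM_comp2_extd hα x hx b, Matrix.sub_apply, Matrix.transpose_apply]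
  have h5 := h3 a b c
  simp only [comp1] at h5 ⊢
  linear_combination S.inv x y b c * h5

end Spacetime
end Komar

/-! ### Clifford algebra and the Dirac operator on closed two-forms -/

namespace Komar

theorem sum_cyclic {X : Type*} [AddCommMonoid X] (f : Fin 4 → Fin 4 → Fin 4 → X) :
    ∑ i, ∑ a, ∑ b, f i a b = ∑ i, ∑ a, ∑ b, f a b i := by
  refine Eq.trans ?_ Finset.sum_comm
  refine Finset.sum_comm.trans ?_
  rw [Finset.sum_comm]
  exact Finset.sum_congr rfl fun i _ => Finset.sum_comm

/-- In an algebra with the Clifford relations, a tensor that is skew in its last two indices and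
has vanishing cyclic sums contracts with `θⁱ θᵃ θᵇ` to twice its divergence. -/
theorem clifford_contract {C : Type*} [Ring C] [Algebra ℝ C] (θ : Fin 4 → C)
    (G : Matrix (Fin 4) (Fin 4) ℝ) (hθ : ∀ i j, θ i * θ j + θ j * θ i = (2 * G i j) • (1 : C))
    (hG : ∀ i j, G i j = G j i) (X : Fin 4 → Fin 4 → Fin 4 → ℝ) (hs : ∀ i a b, X i a b = -X i b a)
    (hc : ∀ i a b, X i a b + X a b i + X b i a = 0) :
    ∑ i, ∑ a, ∑ b, X i a b • (θ i * θ a * θ b) =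
      (2 : ℝ) • ∑ i, ∑ a, ∑ b, (G i a * X i a b) • θ b := by
  have hsw : ∀ f : Fin 4 → Fin 4 → Fin 4 → C,
      ∑ i, ∑ a, ∑ b, X i a b • f i b a = -∑ i, ∑ a, ∑ b, X i a b • f i a b := by
    intro f
    rw [← Finset.sum_neg_distrib]
    refine Finset.sum_congr rfl fun i _ => ?_
    rw [Finset.sum_comm, ← Finset.sum_neg_distrib]
    refine Finset.sum_congr rfl fun a _ => ?_
    rw [← Finset.sum_neg_distrib]
    refine Finset.sum_congr rfl fun b _ => ?_
    rw [hs i b a, neg_smul]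
  set P := ∑ i, ∑ a, ∑ b, X i a b • (θ i * θ a * θ b) with hP
  set D := ∑ i, ∑ a, ∑ b, (G i a * X i a b) • θ b with hD
  have hD1 : ∑ i, ∑ a, ∑ b, X i a b • ((2 * G a i) • θ b) = (2 : ℝ) • D := by
    simp only [hD, Finset.smul_sum, smul_smul]
    refine Finset.sum_congr rfl fun i _ => Finset.sum_congr rfl fun a _ =>
      Finset.sum_congr rfl fun b _ => ?_
    rw [hG a i]
    congr 1
    ring
  have hD2 : ∑ i, ∑ a, ∑ b, X i a b • ((2 * G b i) • θ a) = -((2 : ℝ) • D) := by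
    rw [hsw fun i a b => (2 * G a i) • θ b, hD1]
  -- The Clifford relations bring both cyclic rotations of θⁱθᵃθᵇ back to standard order; after
  -- contraction with X they become P − 2D and P − 4D.
  have h1 : ∀ i a b, θ b * θ i * θ a = (2 * G b i) • θ a - θ i * θ b * θ a := by
    intro i a b
    rw [eq_sub_iff_add_eq, ← add_mul, hθ, smul_mul_assoc, one_mul]
  have h2 : ∀ i a b, θ a * θ b * θ i = (2 * G b i) • θ a - (2 * G a i) • θ b + θ i * θ a * θ b := by
    intro i a b
    have : θ a * θ b * θ i = θ a * (θ b * θ i + θ i * θ b) - (θ a * θ i + θ i * θ a) * θ b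
        + θ i * θ a * θ b := by noncomm_ring
    rw [this, hθ, hθ, smul_mul_assoc, one_mul, mul_smul_comm, mul_one]
  have e1 : ∑ i, ∑ a, ∑ b, X i a b • (θ b * θ i * θ a) = -((2 : ℝ) • D) + P := by
    have : ∀ i a b, X i a b • (θ b * θ i * θ a) =
        X i a b • ((2 * G b i) • θ a) - X i a b • (θ i * θ b * θ a) := fun i a b => by
      rw [h1 i a b, smul_sub]
    rw [Finset.sum_congr rfl fun i _ => Finset.sum_congr rfl fun a _ =>
      Finset.sum_congr rfl fun b _ => this i a b]
    simp only [Finset.sum_sub_distrib]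
    rw [hD2, hsw fun i a b => θ i * θ a * θ b, sub_neg_eq_add]
  have e2 : ∑ i, ∑ a, ∑ b, X i a b • (θ a * θ b * θ i) =
      -((2 : ℝ) • D) - (2 : ℝ) • D + P := by
    have : ∀ i a b, X i a b • (θ a * θ b * θ i) = X i a b • ((2 * G b i) • θ a) -
        X i a b • ((2 * G a i) • θ b) + X i a b • (θ i * θ a * θ b) := fun i a b => by
      rw [h2 i a b, smul_add, smul_sub]
    rw [Finset.sum_congr rfl fun i _ => Finset.sum_congr rfl fun a _ =>
      Finset.sum_congr rfl fun b _ => this i a b]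
    simp only [Finset.sum_sub_distrib, Finset.sum_add_distrib]
    rw [hD2, hD1]
  -- Moving the rotation from the product to X makes the cyclic sum of X appear, so the three
  -- contractions add to zero: 3P = 6D.
  have e3 : P + ∑ i, ∑ a, ∑ b, X i a b • (θ b * θ i * θ a) +
      ∑ i, ∑ a, ∑ b, X i a b • (θ a * θ b * θ i) = 0 := by
    rw [sum_cyclic fun i a b => X i a b • (θ b * θ i * θ a),
      sum_cyclic fun i a b => X i a b • (θ a * θ b * θ i),
      sum_cyclic fun i a b => X a b i • (θ b * θ i * θ a), hP]
    simp only [← Finset.sum_add_distrib, ← add_smul]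
    refine Finset.sum_eq_zero fun i _ => Finset.sum_eq_zero fun a _ =>
      Finset.sum_eq_zero fun b _ => ?_
    rw [← zero_smul ℝ (θ i * θ a * θ b), ← hc i a b]
  rw [e1, e2] at e3
  have e4 : (3 : ℝ) • P = (3 : ℝ) • (2 : ℝ) • D := by
    rw [← sub_eq_zero, ← e3]
    module
  exact smul_right_injective C (by norm_num : (3 : ℝ) ≠ 0) e4

variable {M : Type*} [TopologicalSpace M] [ChartedSpace E4 M]

namespace Spacetime

variable (S : Spacetime M)

theorem cometric_apply (x : M) (a : Tan x →L[ℝ] ℝ) :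
    S.cometric x a = ∑ i, ∑ j, S.ginv x i j * (a (e i) * a (e j)) := by
  rw [cometric, QuadraticMap.comp_apply, Matrix.toQuadraticForm', LinearMap.BilinMap.toQuadraticMap_apply,
    Matrix.toLinearMap₂'_apply]
  simp [mul_comm, mul_left_comm]

theorem theta_mul_theta (x : M) (i j : Fin 4) :
    S.theta x i * S.theta x j + S.theta x j * S.theta x i =
      (2 * S.ginv x i j) • (1 : S.Cliff x) := by
  rw [theta, theta, CliffordAlgebra.ι_mul_ι_add_swap, Algebra.algebraMap_eq_smul_one]
  congr 1
  rw [QuadraticMap.polar, cometric_apply, cometric_apply, cometric_apply]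
  have he : ∀ k l, (EuclideanSpace.proj k : E4 →L[ℝ] ℝ) (e l) = if k = l then 1 else 0 := by
    intro k l
    simp [e]
  have hg : S.ginv x j i = S.ginv x i j := S.inv_symm x (base x) j i
  simp only [add_apply, he, ← Finset.sum_sub_distrib]
  have : ∀ k l : Fin 4, S.ginv x k l * (((if i = k then (1 : ℝ) else 0) + if j = k then 1 else 0) *
      ((if i = l then 1 else 0) + if j = l then 1 else 0)) -
      S.ginv x k l * ((if i = k then 1 else 0) * if i = l then 1 else 0) -
      S.ginv x k l * ((if j = k then 1 else 0) * if j = l then 1 else 0) =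
      (if i = k then if j = l then S.ginv x k l else 0 else 0) +
        if j = k then if i = l then S.ginv x k l else 0 else 0 := by
    intro k l
    split_ifs <;> ring
  simp only [this, Finset.sum_add_distrib, Finset.sum_ite_eq, Finset.mem_univ, if_true,
    Finset.sum_ite_irrel, Finset.sum_const_zero, hg]
  ring

theorem toCliff_one (x : M) (α : Tan x [⋀^Fin 1]→L[ℝ] ℝ) :
    S.toCliff x α = ∑ i, α (fun _ => e i) • S.theta x i := by
  simp [toCliff, sum_fin_one]

theorem toCliff_two (x : M) (β : Tan x [⋀^Fin 2]→L[ℝ] ℝ) :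
    S.toCliff x β = (1 / 2 : ℝ) • ∑ a, ∑ b, β ![e a, e b] • (S.theta x a * S.theta x b) := by
  have he : ∀ i j, (fun k => e (![i, j] k)) = ![e i, e j] := by
    intro i j; funext k; fin_cases k <;> rfl
  rw [toCliff, sum_fin_two]
  simp only [he]
  simp [Nat.factorial]

/-- The linear isomorphism with the exterior algebra fixes covectors, and there the inclusion of
covectors is injective. -/
theorem toCliff_one_injective (x : M) :
    Function.Injective (S.toCliff x : (Tan x [⋀^Fin 1]→L[ℝ] ℝ) → S.Cliff x) := by
  intro α β h
  have key : ∀ γ : Tan x [⋀^Fin 1]→L[ℝ] ℝ, S.toCliff x γ = CliffordAlgebra.ι (S.cometric x)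
      (∑ i, γ (fun _ => e i) • (EuclideanSpace.proj i : E4 →L[ℝ] ℝ)) := by
    intro γ
    rw [toCliff_one, map_sum]
    exact Finset.sum_congr rfl fun i _ => (map_smul _ _ _).symm
  rw [key, key] at h
  have h2 := congrArg (CliffordAlgebra.equivExterior (S.cometric x)) h
  rw [CliffordAlgebra.equivExterior, CliffordAlgebra.changeFormEquiv_apply,
    CliffordAlgebra.changeFormEquiv_apply, CliffordAlgebra.changeForm_ι,
    CliffordAlgebra.changeForm_ι] at h2
  have h3 := (ExteriorAlgebra.ι_inj ℝ _ _).1 h2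
  refine form_one_ext fun j => ?_
  have h4 := congrArg (fun f : E4 →L[ℝ] ℝ => f (e j)) h3
  simpa [sum_apply] using h4

/-- The covariant form of `dF = 0`. -/
theorem gradM_cyclic {β : Form M 2} (hβ : SmoothForm β) (hd : extd β = 0) (x : M) (i a b : Fin 4) :
    S.gradM x i (comp2 (chartForm β x)) (base x) a b +
      S.gradM x a (comp2 (chartForm β x)) (base x) b i +
      S.gradM x b (comp2 (chartForm β x)) (base x) i a = 0 := by
  have hβd := (hβ.contDiffAt x (base_mem_target x)).differentiableAt (by simp)
  have h0 : extDeriv (chartForm β x) (base x) ![e i, e a, e b] = 0 := by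
    change extd β x _ = 0
    rw [hd]; rfl
  have hr : ∀ k : Fin 3, k.removeNth ![e i, e a, e b] =
      ![![e a, e b], ![e i, e b], ![e i, e a]] k := by
    intro k
    funext l
    fin_cases k <;> fin_cases l <;> rfl
  rw [extDeriv_apply hβd, Fin.sum_univ_three, hr, hr, hr] at h0
  have hs : ∀ k l, comp2 (chartForm β x) (base x) k l = -comp2 (chartForm β x) (base x) l k :=
    fun k l => congrFun (congrFun (comp2_skew (chartForm β x) (base x)) l) k
  have hp : pdM a (comp2 (chartForm β x)) (base x) b i =
      -pdM a (comp2 (chartForm β x)) (base x) i b := by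
    have : (pdM a (comp2 (chartForm β x)) (base x)).transpose =
        -pdM a (comp2 (chartForm β x)) (base x) := by
      rw [← pdM_transpose, ← pdM_neg]
      congr 1
      funext z
      exact comp2_skew _ z
    exact congrFun (congrFun this i) b
  have h1 : pdM i (comp2 (chartForm β x)) (base x) a b -
      pdM a (comp2 (chartForm β x)) (base x) i b +
      pdM b (comp2 (chartForm β x)) (base x) i a = 0 := by
    rw [← h0]
    simp only [Fin.val_zero, pow_zero, one_smul, Fin.val_one, pow_one, neg_smul, Fin.val_two,
      Matrix.cons_val]
    norm_num
    exact congrArg₂ _ (sub_eq_add_neg _ _).symm rfl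
  simp only [gradM, Matrix.sub_apply, Matrix.mul_apply, Matrix.transpose_apply, hp]
  have h2 : ∀ p q k, ∑ j, comp2 (chartForm β x) (base x) k j * S.conn x p (base x) j q =
      -∑ j, S.conn x p (base x) j q * comp2 (chartForm β x) (base x) j k := by
    intro p q k
    rw [← Finset.sum_neg_distrib]
    exact Finset.sum_congr rfl fun l _ => by rw [hs k l]; ring
  have h3 : ∀ p q k, ∑ j, S.conn x p (base x) j q * comp2 (chartForm β x) (base x) j k =
      ∑ j, S.conn x q (base x) j p * comp2 (chartForm β x) (base x) j k := fun p q k =>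
    Finset.sum_congr rfl fun l _ => by rw [S.conn_symm x p l q]
  -- The six connection terms cancel in pairs: `h2` uses that β is skew, `h3` that Γ is symmetric.
  rw [h2, h2, h2, h3 i a, h3 i b, h3 a b]
  linear_combination h1

/-- For a closed `2`-form the Dirac operator reduces to the codifferential, `∂β = -δβ`. -/
theorem dirac_of_closed [IsManifold (𝓡 4) ∞ M] {β : Form M 2} (hβ : SmoothForm β) (hd : extd β = 0) (x : M) :
    S.dirac β x = S.toCliff x (-S.codiff 2 rfl β x) := by
  have hβd := (hβ.contDiffAt x (base_mem_target x)).differentiableAt (by simp)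
  have h := clifford_contract (S.theta x) (S.ginv x) (S.theta_mul_theta x) (S.inv_symm x (base x))
    (fun i a b => S.gradM x i (comp2 (chartForm β x)) (base x) a b)
    (fun i a b => congrFun (congrFun (S.gradM_skew x (chartForm β x) i (base x)) b) a)
    (S.gradM_cyclic hβ hd x)
  have h1 : S.dirac β x = (1 / 2 : ℝ) • ∑ i, ∑ a, ∑ b,
      S.gradM x i (comp2 (chartForm β x)) (base x) a b •
        (S.theta x i * S.theta x a * S.theta x b) := by
    simp only [dirac, toCliff_two, S.covD_two_apply x hβd, Finset.smul_sum, Finset.mul_sum,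
      mul_smul_comm, mul_assoc]
  rw [h1, h, smul_smul, S.codiff_two_apply hβ, toCliff_one]
  -- The 1/2! in the embedding of two-forms cancels the 2 of `clifford_contract`.
  rw [one_div_mul_cancel two_ne_zero, one_smul, sum_cyclic]
  refine Finset.sum_congr rfl fun i _ => ?_
  rw [ContinuousAlternatingMap.neg_apply, form1_apply_e, neg_neg, divTwo, Finset.sum_smul]
  refine Finset.sum_congr rfl fun a _ => ?_
  rw [Finset.sum_smul]
  rfl

end Spacetime
end Komar

/-! ### From the Maxwell-like equation to the Einstein equation -/

namespace Komar

theorem matEnd_apply_apply (B : Matrix (Fin 4) (Fin 4) ℝ) (i j : Fin 4) :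
    matEnd B (e j) i = B i j := by
  rw [matEnd_e]
  simp [e, Pi.single_apply]

theorem trace_eq_sum (L : E4 →L[ℝ] E4) :
    LinearMap.trace ℝ E4 (L : E4 →ₗ[ℝ] E4) = ∑ i, L (e i) i := by
  rw [LinearMap.trace_eq_matrix_trace ℝ (EuclideanSpace.basisFun (Fin 4) ℝ).toBasis, Matrix.trace]
  refine Finset.sum_congr rfl fun i _ => ?_
  rw [Matrix.diag_apply, LinearMap.toMatrix_apply]
  simp [e]

variable {M : Type*} [TopologicalSpace M] [ChartedSpace E4 M]

theorem extensor_matEnd_apply (B : M → Matrix (Fin 4) (Fin 4) ℝ) (α : Form M 1) (x : M)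
    (a : Fin 4) : extensor (fun x => matEnd (B x)) α x (fun _ => e a) =
      ∑ m, α x (fun _ => e m) * B x m a := by
  change α x (fun _ => matEnd (B x) (e a)) = _
  rw [matEnd_e, form_one_sum]
  exact Finset.sum_congr rfl fun m _ => mul_comm _ _

namespace Spacetime

variable (S : Spacetime M)

/-- The Ricci tensor as a field of endomorphisms. -/
def ricciEnd : EndField M := fun x => matEnd (S.ginv x * S.ricci x)

theorem einstein_eq (x : M) : S.einstein x =
    S.ricciEnd x - (S.scalar x / 2) • ContinuousLinearMap.id ℝ E4 := by
  rw [einstein, ricciEnd, matEnd, map_sub, map_smul, map_one]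
  rfl

theorem trace_ricciEnd (x : M) : LinearMap.trace ℝ E4 (S.ricciEnd x : E4 →ₗ[ℝ] E4) = S.scalar x := by
  rw [trace_eq_sum, scalar, Finset.sum_comm]
  refine Finset.sum_congr rfl fun i _ => ?_
  rw [ricciEnd, matEnd_apply_apply, Matrix.mul_apply]
  exact Finset.sum_congr rfl fun j _ => by rw [show S.ginv x i j = S.ginv x j i from S.inv_symm x _ i j]

theorem trace_smul_id (c : ℝ) :
    LinearMap.trace ℝ E4 ((c • ContinuousLinearMap.id ℝ E4 : E4 →L[ℝ] E4) : E4 →ₗ[ℝ] E4) = 4 * c := by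
  rw [trace_eq_sum]
  simp [e]

/-- The trace-reversed form of the Einstein equation at a point. -/
theorem einstein_eq_neg_iff (T : EndField M) (x : M) : S.einstein x = -T x ↔
    S.ricciEnd x = -T x + (trace T x / 2) • ContinuousLinearMap.id ℝ E4 := by
  have hR := S.trace_ricciEnd x
  have h1 := trace_smul_id (S.scalar x / 2)
  have h2 := trace_smul_id (trace T x / 2)
  rw [trace_eq_sum] at hR h1 h2
  have hT : trace T x = ∑ i, T x (e i) i := trace_eq_sum (T x)
  rw [einstein_eq]
  constructor
  · intro h
    -- The identity has trace 4, so the trace of the equation reads R − 2R = −tr T.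
    have h3 : S.scalar x = trace T x := by
      have := congrArg (fun L : E4 →L[ℝ] E4 => ∑ i, L (e i) i) h
      simp only [sub_apply, neg_apply, PiLp.sub_apply, PiLp.neg_apply, Finset.sum_sub_distrib,
        Finset.sum_neg_distrib, h1, hR, ← hT] at this
      linarith
    rw [← h3, ← h, sub_add_cancel]
  · intro h
    -- Here the trace reads R = −tr T + 2 tr T.
    have h3 : S.scalar x = trace T x := by
      have := congrArg (fun L : E4 →L[ℝ] E4 => ∑ i, L (e i) i) h
      simp only [add_apply, neg_apply, PiLp.add_apply, PiLp.neg_apply, Finset.sum_add_distrib,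
        Finset.sum_neg_distrib, h2, hR, ← hT] at this
      linarith
    rw [h, h3, add_sub_cancel_right]

theorem g_nondegenerate (x : M) {u : Tan x} (h : ∀ v : Tan x, S.g x v u = 0) : u = 0 := by
  obtain ⟨b, hb⟩ := S.signature x
  rw [← b.sum_repr u]
  refine Finset.sum_eq_zero fun i _ => ?_
  have h1 := h (b i)
  rw [← b.sum_repr u, map_sum] at h1
  simp only [map_smul, hb, minkowski, Matrix.diagonal_apply, smul_eq_mul, mul_ite, mul_zero,
    Finset.sum_ite_eq, Finset.mem_univ, if_true] at h1
  have h2 : (![1, -1, -1, -1] : Fin 4 → ℝ) i ≠ 0 := by fin_cases i <;> simp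
  rw [(mul_eq_zero.1 h1).resolve_right h2, zero_smul]

variable [IsManifold (𝓡 4) ∞ M]

theorem covD_one_contDiffAt {α : Form M 1} (hα : SmoothForm α) {y : E4} (x : M)
    (hx : y ∈ (extChartAt (𝓡 4) x).target) (j : Fin 4) :
    ContDiffAt ℝ ∞ (S.covD x j (chartForm α x)) y := by
  have h : ContDiffOn ℝ ∞ (S.covD x j (chartForm α x)) (extChartAt (𝓡 4) x).target := by
    refine contDiffOn_form fun a => ContDiffOn.congr
      (f := fun z => S.grad x (comp1 (chartForm α x)) z j (a 0)) (fun z hz => ?_) fun z hz => ?_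
    · exact (S.smoothMatAt_grad x hz (fun _ => contDiffAt_form_apply (hα.contDiffAt x hz) _)
        j (a 0)).contDiffWithinAt
    · rw [← S.covD_one_apply x ((hα.contDiffAt x hz).differentiableAt (by simp))]
      congr 1
      funext i
      rw [Subsingleton.elim i 0]
  exact h.contDiffAt ((isOpen_chart_target x).mem_nhds hx)

/-- The index j is only a label in `covD`, so just the form index is corrected. The correction of j
is the term Γᵏᵢⱼ D_k in `dAlembert`, and together they give `gradM`. -/
theorem covD_covD_one_apply {α : Form M 1} (hα : SmoothForm α) {y : E4} (x : M)
    (hx : y ∈ (extChartAt (𝓡 4) x).target) (i j a : Fin 4) :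
    S.covD x i (S.covD x j (chartForm α x)) y (fun _ => e a) =
      pdM i (S.grad x (comp1 (chartForm α x))) y j a -
        ∑ k, S.conn x i y k a * S.grad x (comp1 (chartForm α x)) y j k := by
  have h : ∀ z ∈ (extChartAt (𝓡 4) x).target, ∀ k,
      comp1 (S.covD x j (chartForm α x)) k z = S.grad x (comp1 (chartForm α x)) z j k :=
    fun z hz k => S.covD_one_apply x ((hα.contDiffAt x hz).differentiableAt (by simp)) j k
  rw [S.covD_one_apply x ((S.covD_one_contDiffAt hα x hx j).differentiableAt (by simp))]
  rw [grad, Matrix.of_apply]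
  congr 1
  · refine pd_congr i ?_
    filter_upwards [(isOpen_chart_target x).mem_nhds hx] with z hz
    exact h z hz a
  · exact Finset.sum_congr rfl fun k _ => by rw [h y hx k]

theorem dAlembert_one_apply {α : Form M 1} (hα : SmoothForm α) (x : M) (a : Fin 4) :
    S.dAlembert α x (fun _ => e a) = ∑ b, ∑ c, S.inv x (base x) b c *
      S.gradM x b (S.grad x (comp1 (chartForm α x))) (base x) c a := by
  have hx := base_mem_target x
  have hd := (hα.contDiffAt x hx).differentiableAt (by simp)
  simp only [dAlembert, ContinuousAlternatingMap.sum_apply, ContinuousAlternatingMap.smul_apply,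
    ContinuousAlternatingMap.sub_apply, S.covD_covD_one_apply hα x hx, S.covD_one_apply x hd,
    smul_eq_mul]
  refine Finset.sum_congr rfl fun b _ => Finset.sum_congr rfl fun c _ => ?_
  rw [gradM, Matrix.sub_apply, Matrix.sub_apply, Matrix.mul_apply, Matrix.mul_apply]
  have h1 : ∀ k, S.grad x (comp1 (chartForm α x)) (base x) c k * S.conn x b (base x) k a =
      S.conn x b (base x) k a * S.grad x (comp1 (chartForm α x)) (base x) c k :=
    fun k => mul_comm _ _
  simp only [h1]
  change S.inv x (base x) b c * _ = _
  congr 1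
  exact sub_right_comm _ _ _

/-- The Weitzenböck formula `-δdα = ∂·∂α + dδα + Ric(α)` for `1`-forms. -/
theorem codiff_extd {α : Form M 1} (hα : SmoothForm α) (x : M) :
    S.codiff 2 rfl (extd α) x =
      -(S.dAlembert α x + extd (S.codiff 3 rfl α) x + extensor S.ricciEnd α x) := by
  refine form_one_ext fun a => ?_
  have h : extensor S.ricciEnd α x (fun _ => e a) = ∑ m, comp1 (chartForm α x) m (base x) *
      (S.inv x (base x) * Matrix.of fun r s => ∑ k, S.riemann x k r s k (base x)) m a := by
    refine (extensor_matEnd_apply _ α x a).trans ?_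
    simp only [comp1, chartForm_base]
    rfl
  rw [S.codiff_two_apply hα.extd, form1_apply_e, S.weitzenbock hα x (base_mem_target x) a, ← h,
    ← S.dAlembert_one_apply hα, ContinuousAlternatingMap.neg_apply,
    ContinuousAlternatingMap.add_apply, ContinuousAlternatingMap.add_apply,
    S.extd_codiff_apply hα]
  ring

/-- As F is exact, both sides of the Clifford equation come from one-forms, and the embedding of
one-forms is injective. -/
theorem maxwellLike_iff_codiff (T : EndField M) {A : VField M} (hA : SmoothVField A) :
    S.MaxwellLike T A ↔ S.codiff 2 rfl (S.field A) = -S.komarCurrent T A := by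
  have hF := S.smoothForm_flat hA
  constructor
  · intro h
    funext x
    have h1 := h x
    rw [field, S.dirac_of_closed hF.extd hF.extd_extd] at h1
    have h2 := S.toCliff_one_injective x h1
    rw [Pi.neg_apply, ← h2, neg_neg]
    rfl
  · intro h x
    rw [field, S.dirac_of_closed hF.extd hF.extd_extd]
    congr 1
    have := congrFun h x
    rw [Pi.neg_apply] at this
    rw [← field, this, neg_neg]

/-- The Maxwell-like equation as an equation for the Ricci tensor. -/
theorem maxwellLike_iff_ricci (T : EndField M) {A : VField M} (hA : SmoothVField A) :
    S.MaxwellLike T A ↔ ∀ x : M, ∀ w : Tan x, S.g x (A x)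
      ((S.ricciEnd x - (-T x + (trace T x / 2) • ContinuousLinearMap.id ℝ E4)) w) = 0 := by
  have hF := S.smoothForm_flat hA
  rw [S.maxwellLike_iff_codiff T hA, funext_iff]
  refine forall_congr' fun x => ?_
  -- After this, dδA and ∂·∂A appear identically on both sides, so only algebraic terms in A remain.
  rw [field, S.codiff_extd hF, Pi.neg_apply, neg_inj]
  have key : ∀ w : Tan x, S.g x (A x)
      ((S.ricciEnd x - (-T x + (trace T x / 2) • ContinuousLinearMap.id ℝ E4)) w) =
      extensor S.ricciEnd (S.flat A) x (fun _ => w) +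
        extensor T (S.flat A) x (fun _ => w) - trace T x / 2 * S.flat A x (fun _ => w) := by
    intro w
    simp only [sub_apply, add_apply, neg_apply, map_sub, map_add, map_neg, smul_apply, map_smul,
      smul_eq_mul, ContinuousLinearMap.id_apply]
    change _ = S.g x (A x) (S.ricciEnd x w) + S.g x (A x) (T x w) -
      trace T x / 2 * S.g x (A x) w
    ring
  simp only [key, komarCurrent]
  constructor
  · intro h w
    have h1 := congrArg (fun γ : E4 [⋀^Fin 1]→L[ℝ] ℝ => γ (fun _ => w)) h
    simp only [ContinuousAlternatingMap.add_apply, ContinuousAlternatingMap.neg_apply,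
      ContinuousAlternatingMap.smul_apply, smul_eq_mul] at h1
    linarith
  · intro h
    refine form_one_ext fun j => ?_
    have h1 := h (e j)
    simp only [ContinuousAlternatingMap.add_apply, ContinuousAlternatingMap.neg_apply,
      ContinuousAlternatingMap.smul_apply, smul_eq_mul]
    linarith

/-- The contracted trace-reversed equation is linear in the value of A at x: it extends from the
given values to their span, and nondegeneracy of g then removes the contraction. -/
theorem einsteinEquation_of_span (T : EndField M) (V : Set (VField M))
    (hV : ∀ A ∈ V, SmoothVField A)
    (hspan : ∀ x : M, Submodule.span ℝ {v : Tan x | ∃ A ∈ V, A x = v} = ⊤)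
    (h : ∀ A ∈ V, S.MaxwellLike T A) : S.EinsteinEquation T := by
  intro x
  rw [S.einstein_eq_neg_iff, ← sub_eq_zero]
  refine ContinuousLinearMap.ext fun w => S.g_nondegenerate x fun v => ?_
  have hv : v ∈ Submodule.span ℝ {v : Tan x | ∃ A ∈ V, A x = v} := hspan x ▸ Submodule.mem_top
  induction hv using Submodule.span_induction with
  | mem v hv =>
    obtain ⟨A, hA, rfl⟩ := hv
    exact (S.maxwellLike_iff_ricci T (hV A hA)).1 (h A hA) x w
  | zero => rw [map_zero]; rfl
  | add v u _ _ h1 h2 => rw [map_add, add_apply, h1, h2, add_zero]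
  | smul c v _ h1 => rw [map_smul, smul_apply, h1, smul_zero]

theorem maxwellLike_of_einsteinEquation {T : EndField M} (h : S.EinsteinEquation T) {A : VField M}
    (hA : SmoothVField A) : S.MaxwellLike T A := by
  refine (S.maxwellLike_iff_ricci T hA).2 fun x w => ?_
  rw [sub_eq_zero.2 ((S.einstein_eq_neg_iff T x).1 (h x))]
  exact map_zero _

/-- With R = tr T, the trace-reversed difference Ric + T − ½(tr T) is G + T itself. -/
theorem maxwellLike_iff_extensor_einstein (T : EndField M)
    (hR : ∀ x : M, S.scalar x = trace T x) {A : VField M} (hA : SmoothVField A) :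
    S.MaxwellLike T A ↔ extensor S.einstein (S.flat A) = -extensor T (S.flat A) := by
  rw [S.maxwellLike_iff_ricci T hA, funext_iff]
  refine forall_congr' fun x => ?_
  have key : ∀ w : Tan x, S.g x (A x)
      ((S.ricciEnd x - (-T x + (trace T x / 2) • ContinuousLinearMap.id ℝ E4)) w) =
      extensor S.einstein (S.flat A) x (fun _ => w) + extensor T (S.flat A) x (fun _ => w) := by
    intro w
    change _ = S.g x (A x) (S.einstein x w) + S.g x (A x) (T x w)
    rw [← map_add, einstein_eq, hR x]
    congr 1
    simp only [sub_apply, add_apply, neg_apply]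
    abel
  simp only [key, Pi.neg_apply]
  constructor
  · intro h
    refine form_one_ext fun j => ?_
    rw [ContinuousAlternatingMap.neg_apply]
    linarith [h (e j)]
  · intro h w
    rw [h, ContinuousAlternatingMap.neg_apply, neg_add_cancel]

theorem codiff_komarCurrent {T : EndField M} {A : VField M} (hA : SmoothVField A)
    (h : S.MaxwellLike T A) : S.codiff 3 rfl (S.komarCurrent T A) = 0 := by
  have h1 : S.komarCurrent T A = -S.codiff 2 rfl (S.field A) := by
    rw [(S.maxwellLike_iff_codiff T hA).1 h, neg_neg]
  rw [h1, codiff_neg_one, field, S.codiff_codiff (S.smoothForm_flat hA).extd, neg_zero]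

end Spacetime
end Komar

end

theorem mainTheorem3 {M : Type*} [TopologicalSpace M] [T2Space M] [ChartedSpace Komar.E4 M]
    [IsManifold (𝓡 4) ∞ M] (S : Komar.Spacetime M) (T : Komar.EndField M) :
    -- the Einstein equation is equivalent to the Maxwell-like equations of all vector fields
    (S.EinsteinEquation T ↔ ∀ A : Komar.VField M, Komar.SmoothVField A → S.MaxwellLike T A) ∧
    -- a family of vector fields that spans all tangent spaces suffices to recover it
    (∀ V : Set (Komar.VField M), (∀ A ∈ V, Komar.SmoothVField A) →
      (∀ x : M, Submodule.span ℝ {v : Komar.Tan x | ∃ A ∈ V, A x = v} = ⊤) →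
      (∀ A ∈ V, S.MaxwellLike T A) → S.EinsteinEquation T) ∧
    ∀ A : Komar.VField M, Komar.SmoothVField A →
      -- the equation `∂F = J_A` says that `dF = 0` and `δF = - J_A`
      (S.MaxwellLike T A ↔
        Komar.extd (S.field A) = 0 ∧ S.codiff 2 rfl (S.field A) = - S.komarCurrent T A) ∧
      -- for a single `A`, given `R = tr T`, it is the Einstein equation contracted with `A`
      ((∀ x : M, S.scalar x = Komar.Spacetime.trace T x) →
        (S.MaxwellLike T A ↔
          Komar.extensor S.einstein (S.flat A) = - Komar.extensor T (S.flat A))) ∧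
      -- the current is conserved
      (S.MaxwellLike T A → S.codiff 3 rfl (S.komarCurrent T A) = 0) := by
  refine ⟨⟨fun h A hA => S.maxwellLike_of_einsteinEquation h hA, fun h => ?_⟩,
    S.einsteinEquation_of_span T, fun A hA => ⟨?_,
      fun hR => S.maxwellLike_iff_extensor_einstein T hR hA, S.codiff_komarCurrent hA⟩⟩
  · refine S.einsteinEquation_of_span T {A | Komar.SmoothVField A} (fun _ hA => hA) (fun x => ?_) h
    refine Submodule.eq_top_iff'.2 fun v => Submodule.subset_span ?_
    exact Komar.exists_smoothVField x v
  · rw [S.maxwellLike_iff_codiff T hA]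
    exact (and_iff_right (S.smoothForm_flat hA).extd_extd).symm
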